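/- **Model.** There are $n\ge 1$ experts and $T\ge 1$ days. On day $t$ expert $e$ makes a prediction $x_t(e)\in[0,1]$ and incurs a loss $\ell_t(e)\in[0,1]$. The predictions and losses are fixed in advance by an oblivious adversary. A word of memory holds $\lfloor\log_2(nT)\rfloor+1$ bits. A randomized algorithm keeps a memory state consisting of finitely many words, and this is all it remembers from one day to the next. Its initial state is drawn using random bits. On each day $t$ the words of its memory state include the names of a set $E_t$ of experts; the algorithm observes the predictions of the experts in $E_t$, follows some expert $i_t\in E_t$, then observes the losses of the experts in $E_t$, and updates its memory state, where both choices may use fresh independent fair random bits, which are not charged to the memory. The algorithm uses space at most $M$ if, for all predictions, all losses and all outcomes of its random bits, its memory state never consists of more than $M$ words. Its regret is $$\mathrm{Regret}=\sum_{t=1}^{T}\ell_t(i_t)-\min_{e}\sum_{t=1}^{T}\ell_t(e).$$ **Theorem.** Let $\delta\in(0,1)$. There is a family of such algorithms $A_{n,T}$ (for all integers $n,T\ge 1$) such that for every constant $c\in\mathbb N$ the following hold. 1. There are constants $C$ and $K$, depending only on $\delta$ and $c$, such that for all $n,T\ge1$ with $T\le n^{c}$, the algorithm $A_{n,T}$ uses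 space at most $C\,n^{\delta}\,(1+\log(nT))^{K}$. 2. For every constant $\gamma\in\mathbb N$ there are constants $C$ and $K$, depending only on $\delta$, $c$ and $\gamma$, such that for all $n,T\ge1$ with $T\le n^{c}$ and every sequence of predictions and losses fixed in advance, with probability at least $1-T^{-\gamma}$ over its random bits $A_{n,T}$ has $$\mathrm{Regret}\le C\,n^{2}\,T^{1/(1+\delta)}\,(1+\log(nT))^{K}.$$ -/

import Mathlib

/-- A word of memory, holding `⌊log₂ (n T)⌋ + 1` bits.  Constant factors in the word length are
absorbed in the number of words. -/
abbrev Word (n T : ℕ) : Type := Fin (2 ^ (Nat.log 2 (n * T) + 1))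

/-- A randomized algorithm for the online experts problem with `n` experts and `T` days in the
bounded-memory query model.

A memory state is a list of words (`words` is injective: nothing but the content of the words is
remembered from one day to the next; even the number of the day has to be stored).  The words of the state at
the beginning of a day contain the names of all experts that are queried on that day.  On each day
the algorithm sees the predictions of the queried experts, follows one of them, sees the losses of
the queried experts, and moves to a new memory state.  It has `numBits` fresh random bits for
the initialization and for each day; the random bits are not charged to the memory, and those of
a day can be consulted later only as far as they were written to memory. -/
structure ExpertAlgorithm (n T : ℕ) where
  /-- the memory states -/
  State : Type
  /-- the words of memory that make up a state -/
  words : State → List (Word n T)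
  words_injective : Function.Injective words
  /-- the experts queried on a day that starts in a given state -/
  query : State → Finset (Fin n)
  query_stored : ∀ s, ∀ e ∈ query s, ∃ w ∈ words s, w.val = e.val
  /-- the number of random bits drawn at initialization and on each day -/
  numBits : ℕ
  /-- the random initial state -/
  init : (Fin numBits → Bool) → State
  /-- the expert followed, given the state, the predictions of the queried experts and the
  random bits of the day -/
  play : (s : State) → ({e // e ∈ query s} → unitInterval) →
    (Fin numBits → Bool) → {e // e ∈ query s}
  /-- the next state, given the state, the predictions and the losses of the queried experts and
  the random bits of the day -/
  update : (s : State) → ({e // e ∈ query s} → unitInterval) → ({e // e ∈ query s} → unitInterval) →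
    (Fin numBits → Bool) → State

namespace ExpertAlgorithm

variable {n T : ℕ} (A : ExpertAlgorithm n T)

/-- All random bits of a run: block `0` serves the initialization, block `t.succ` serves day `t`. -/
abbrev Tape : Type := Fin (T + 1) → Fin A.numBits → Bool

/-- The memory state after `t` days, when expert `e` predicts `x t e` and incurs
loss `l t e` on day `t`. -/
def state (x l : Fin T → Fin n → unitInterval) (ω : A.Tape) : Fin (T + 1) → A.State :=
  Fin.induction (motive := fun _ => A.State) (A.init (ω 0))
    (fun t s => A.update s (fun e => x t e.1) (fun e => l t e.1) (ω t.succ))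

/-- The expert followed on day `t`. -/
def played (x l : Fin T → Fin n → unitInterval) (ω : A.Tape) (t : Fin T) : Fin n :=
  (A.play (A.state x l ω t.castSucc) (fun e => x t e.1) (ω t.succ)).1

/-- Total loss of the algorithm minus the total loss of the best expert in hindsight. -/
noncomputable def regret (x l : Fin T → Fin n → unitInterval) (ω : A.Tape) : ℝ :=
  (∑ t, (l t (A.played x l ω t) : ℝ)) - ⨅ i : Fin n, ∑ t, (l t i : ℝ)

/-- The algorithm never occupies more than `M` words, whatever the input and the random bits. -/
def SpaceAtMost (M : ℝ) : Prop :=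
  ∀ (x l : Fin T → Fin n → unitInterval) (ω : A.Tape) (t : Fin (T + 1)),
    ((A.words (A.state x l ω t)).length : ℝ) ≤ M

/-- The probability of an event over uniformly random independent bits. -/
noncomputable def prob (S : Set A.Tape) : ℝ :=
  (PMF.uniformOfFintype A.Tape).toMeasure.real S

end ExpertAlgorithm

/-! Let `q = ⌈n ^ δ⌉`. The algorithm is a hierarchy of about `log T / log (n q)` levels. Each level
runs exponential weights on the algorithm formed by the levels below and on a pool of experts; it
starts the weights afresh in every epoch, and the epochs of a level are `n q` times as long as
those of the level below. A random expert joins the pool in every epoch. An expert is evicted as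
soon as the older experts in the pool have been at most `R / q` per epoch worse than it since it
joined, where `R` bounds the regret of the levels below in an epoch. Hence a pool entry that
survives beats its elders by more than `R / q` per epoch, and a harmonic sum bounds the size of the
pool by `q log`.

For a fixed expert split the `n q` epochs of an instance into intervals on which the older experts
cover it, at a total cost of at most `n q · R / q = n R`, and epochs in which it would stay to the
end if it joined. The latter are trials that succeed with probability at least `1 / (2 n)`, so with
high probability there are only `n polylog` of them before the expert joins. Hence a level
multiplies the time by `n q` but the regret only by `n polylog`, and the regret after all the levels
is about `n ^ (log T / log (n q)) ≤ T ^ (1 / (1 + δ))`, up to factors `n ^ 2` and `polylog`. -/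

open Finset Function

section Trials

variable (D hit : ℕ → Prop)

/-- Among the times before `m`, no trial, that is, no time at which `D` holds, is a hit. -/
def NoSuccess (m : ℕ) : Prop := ∀ s < m, D s → ¬ hit s

open scoped Classical in
/-- The number of trials before time `m` that are preceded only by failures and fail themselves;
in a run with a success these are the trials before the first success. -/
noncomputable def failedTrials (m : ℕ) : ℕ := #{s ∈ range m | D s ∧ NoSuccess D hit (s + 1)}

variable {D hit}

theorem noSuccess_succ {m : ℕ} :
    NoSuccess D hit (m + 1) ↔ NoSuccess D hit m ∧ (D m → ¬ hit m) :=
  Nat.forall_lt_succ_right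

theorem failedTrials_succ_of_fail {m : ℕ} (hD : D m) (h : NoSuccess D hit (m + 1)) :
    failedTrials D hit (m + 1) = failedTrials D hit m + 1 := by
  simp [failedTrials, range_add_one, filter_insert, hD, h]

theorem failedTrials_succ_of_not {m : ℕ} (h : ¬ (D m ∧ NoSuccess D hit (m + 1))) :
    failedTrials D hit (m + 1) = failedTrials D hit m := by
  simp [failedTrials, range_add_one, filter_insert, h]

open scoped Classical in
theorem monotone_failedTrials : Monotone (failedTrials D hit) := fun _ _ h =>
  card_le_card (filter_subset_filter _ (range_subset_range.2 h))

theorem noSuccess_congr {D' hit' : ℕ → Prop} {m : ℕ} (hD : ∀ s < m, D s ↔ D' s)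
    (hhit : ∀ s < m, hit s ↔ hit' s) : NoSuccess D hit m ↔ NoSuccess D' hit' m :=
  forall₂_congr fun s hs => by rw [hD s hs, hhit s hs]

open scoped Classical in
theorem failedTrials_congr {D' hit' : ℕ → Prop} {m : ℕ} (hD : ∀ s < m, D s ↔ D' s)
    (hhit : ∀ s < m, hit s ↔ hit' s) : failedTrials D hit m = failedTrials D' hit' m := by
  unfold failedTrials
  refine congrArg card (filter_congr fun s hs => ?_)
  have hs := mem_range.1 hs
  exact and_congr (hD s hs) (noSuccess_congr (fun r hr => hD r (by omega))
    fun r hr => hhit r (by omega))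

open scoped Classical in
/-- When each trial succeeds with probability `p`, this bounds the conditional probability that `M`
trials fail before the first success, given that `f` trials have failed so far and that `alive`
tells whether there was no success yet. -/
noncomputable def failureWeight (p : ℝ) (M f : ℕ) (alive : Prop) : ℝ :=
  if M ≤ f ∨ alive then (1 - p) ^ (M - f) else 0

theorem failureWeight_nonneg {p : ℝ} (hp : p ≤ 1) (M f : ℕ) (alive : Prop) :
    0 ≤ failureWeight p M f alive := by
  have := sub_nonneg.2 hp
  unfold failureWeight
  split_ifs <;> positivity

theorem failureWeight_of_le (p : ℝ) {M f : ℕ} (h : M ≤ f) (alive : Prop) :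
    failureWeight p M f alive = 1 := by
  simp [failureWeight, h]

theorem failureWeight_false_le {p : ℝ} (hp : p ≤ 1) (M f : ℕ) :
    failureWeight p M f False ≤ failureWeight p M (f + 1) True := by
  rcases le_or_gt M f with h | h
  · rw [failureWeight_of_le p h, failureWeight_of_le p (by omega)]
  · simpa [failureWeight, h.not_ge] using failureWeight_nonneg hp M (f + 1) True

theorem failureWeight_step (p : ℝ) (M f : ℕ) :
    p * failureWeight p M f False + (1 - p) * failureWeight p M (f + 1) True =
      failureWeight p M f True := by
  rcases le_or_gt M f with h | h
  · simp only [failureWeight_of_le p h, failureWeight_of_le p (show M ≤ f + 1 by omega)]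
    ring
  · have hM : M - f = M - (f + 1) + 1 := by omega
    simp only [failureWeight, h.not_ge, or_false, or_true, if_true, if_false, hM, pow_succ]
    ring

end Trials

theorem exp_le_one_add_add_sq {x b : ℝ} (hx : |x| ≤ b) (hb : b ≤ 1) :
    Real.exp x ≤ 1 + x + b ^ 2 := by
  have h := (abs_le.1 (Real.abs_exp_sub_one_sub_id_le (hx.trans hb))).2
  have hsq : x ^ 2 ≤ b ^ 2 := sq_le_sq' (abs_le.1 hx).1 (abs_le.1 hx).2
  linarith

section Resampling

variable {κ U : Type*} [DecidableEq κ]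

theorem apply_update_of_dependsOn {β : Type*} {f : (κ → U) → β} {c : κ} (hf : DependsOn f {c}ᶜ)
    (ω : κ → U) (u : U) : f (update ω c u) = f ω :=
  hf fun _ hi => update_of_ne hi _ _

variable [Fintype U] {N : ℕ} {c : ℕ → κ}

open scoped Classical in
theorem sum_ite_failureWeight_le {p : ℝ} (hp : p ≤ 1) {good : U → Prop}
    (hgood : p * Fintype.card U ≤ #{u : U | good u}) (M f : ℕ) :
    ∑ u, (if good u then failureWeight p M f False else failureWeight p M (f + 1) True) ≤
      Fintype.card U * failureWeight p M f True := by
  have hcard : (#{u : U | good u} : ℝ) + #{u : U | ¬ good u} = Fintype.card U := by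
    exact_mod_cast card_filter_add_card_filter_not (s := (univ : Finset U)) good
  rw [sum_ite, sum_const, sum_const, nsmul_eq_mul, nsmul_eq_mul, ← failureWeight_step p M f,
    ← hcard]
  rw [← hcard] at hgood
  nlinarith [mul_nonneg (sub_nonneg.2 hgood) (sub_nonneg.2 (failureWeight_false_le hp M f))]

open scoped Classical in
theorem sum_failureWeight_update_le {p : ℝ} (hp : p ≤ 1) {good : U → Prop}
    (hgood : p * Fintype.card U ≤ #{u : U | good u}) {D : ℕ → (κ → U) → Prop}
    (hc : Set.InjOn c (Set.Iio N)) (hD : ∀ s r, s ≤ r → r < N → DependsOn (D s) {c r}ᶜ)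
    (M : ℕ) {m : ℕ} (hm : m < N) (ω : κ → U) :
    ∑ u, failureWeight p M
        (failedTrials (D · (update ω (c m) u)) (fun s => good (update ω (c m) u (c s))) (m + 1))
        (NoSuccess (D · (update ω (c m) u)) (fun s => good (update ω (c m) u (c s))) (m + 1)) ≤
      Fintype.card U * failureWeight p M (failedTrials (D · ω) (fun s => good (ω (c s))) m)
        (NoSuccess (D · ω) (fun s => good (ω (c s))) m) := by
  set f := failedTrials (D · ω) (fun s => good (ω (c s))) m
  set alive := NoSuccess (D · ω) (fun s => good (ω (c s))) m
  have hDu (u) : ∀ s ≤ m, D s (update ω (c m) u) ↔ D s ω := fun s hs =>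
    iff_of_eq (apply_update_of_dependsOn (hD s m hs hm) ω u)
  have hgu (u) : ∀ s < m, good (update ω (c m) u (c s)) ↔ good (ω (c s)) := fun s hs => by
    rw [update_of_ne fun h => hs.ne (hc (hs.trans hm) hm h)]
  have hf (u) : failedTrials (D · (update ω (c m) u)) (fun s => good (update ω (c m) u (c s))) m =
      f := failedTrials_congr (fun s hs => hDu u s hs.le) (hgu u)
  have halive (u) : NoSuccess (D · (update ω (c m) u)) (fun s => good (update ω (c m) u (c s)))
      (m + 1) ↔ alive ∧ (D m ω → ¬ good u) := by
    rw [noSuccess_succ, noSuccess_congr (fun s hs => hDu u s hs.le) (hgu u), hDu u m le_rfl,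
      update_self]
  by_cases htrial : D m ω ∧ alive
  · have hterm (u) : failureWeight p M
        (failedTrials (D · (update ω (c m) u)) (fun s => good (update ω (c m) u (c s))) (m + 1))
        (NoSuccess (D · (update ω (c m) u)) (fun s => good (update ω (c m) u (c s))) (m + 1)) =
        if good u then failureWeight p M f False else failureWeight p M (f + 1) True := by
      split_ifs with hu
      · rw [failedTrials_succ_of_not (by simp [halive, htrial, hu]), hf]
        simp [halive, htrial, hu]
      · rw [failedTrials_succ_of_fail ((hDu u m le_rfl).2 htrial.1) (by simp [halive, htrial, hu]),
          hf]
        simp [halive, htrial, hu]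
    rw [sum_congr rfl fun u _ => hterm u, eq_true htrial.2]
    exact sum_ite_failureWeight_le hp hgood M f
  · have hterm (u) : failureWeight p M
        (failedTrials (D · (update ω (c m) u)) (fun s => good (update ω (c m) u (c s))) (m + 1))
        (NoSuccess (D · (update ω (c m) u)) (fun s => good (update ω (c m) u (c s))) (m + 1)) =
        failureWeight p M f alive := by
      rw [failedTrials_succ_of_not (by rw [halive, hDu u m le_rfl]; tauto), hf]
      congr 1
      rw [halive]
      exact propext (by tauto)
    simp [hterm]

theorem sum_exp_mul_le {y : U → ℝ} (hy0 : ∀ u, 0 ≤ y u) (hy1 : ∀ u, y u ≤ 1) {a : ℝ}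
    (hmean : ∑ u, y u ≤ Fintype.card U * a) {lam : ℝ} (hlam0 : 0 ≤ lam) (hlam1 : lam ≤ 1) :
    ∑ u, Real.exp (lam * y u) ≤ Fintype.card U * Real.exp (lam * a + lam ^ 2) := by
  have hexp (u) : Real.exp (lam * y u) ≤ 1 + lam * y u + lam ^ 2 := by
    refine exp_le_one_add_add_sq ?_ hlam1
    rw [abs_of_nonneg (mul_nonneg hlam0 (hy0 u))]
    exact mul_le_of_le_one_right hlam0 (hy1 u)
  calc ∑ u, Real.exp (lam * y u) ≤ ∑ u, (1 + lam * y u + lam ^ 2) :=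
        sum_le_sum fun u _ => hexp u
    _ = Fintype.card U * (1 + lam ^ 2) + lam * ∑ u, y u := by
        simp only [sum_add_distrib, mul_sum, sum_const, card_univ, nsmul_eq_mul]
        ring
    _ ≤ Fintype.card U * (1 + lam ^ 2) + lam * (Fintype.card U * a) := by gcongr
    _ = Fintype.card U * ((lam * a + lam ^ 2) + 1) := by ring
    _ ≤ Fintype.card U * Real.exp (lam * a + lam ^ 2) := by
        gcongr
        exact Real.add_one_le_exp _

variable [Fintype κ]

/-- Resampling one coordinate of a uniformly random function does not change its law. -/
theorem sum_sum_update (c : κ) (f : (κ → U) → ℝ) :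
    ∑ ω, ∑ u, f (update ω c u) = Fintype.card U * ∑ ω, f ω := by
  have hswap : Involutive fun z : (κ → U) × U => (update z.1 c z.2, z.1 c) := by
    rintro ⟨ω, u⟩
    simp
  have h : ∑ z : (κ → U) × U, f (update z.1 c z.2) = ∑ z : (κ → U) × U, f z.1 :=
    Fintype.sum_equiv hswap.toPerm _ _ fun _ => rfl
  rw [Fintype.sum_prod_type, Fintype.sum_prod_type] at h
  rw [h]
  simp [mul_sum]

variable [Nonempty U]

theorem sum_le_sum_of_sum_update_le {Z : ℕ → (κ → U) → ℝ}
    (h : ∀ m < N, ∀ ω, ∑ u, Z (m + 1) (update ω (c m) u) ≤ Fintype.card U * Z m ω) :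
    ∑ ω, Z N ω ≤ ∑ ω, Z 0 ω := by
  induction N with
  | zero => rfl
  | succ N ih =>
    refine le_trans ?_ (ih fun m hm => h m (by omega))
    have hU : (0 : ℝ) < Fintype.card U := by exact_mod_cast Fintype.card_pos
    refine le_of_mul_le_mul_left ?_ hU
    rw [← sum_sum_update (c N), mul_sum]
    exact sum_le_sum fun ω _ => h N (by omega) ω

open scoped Classical in
theorem card_le_failedTrials_le {p : ℝ} (hp : p ≤ 1) {good : U → Prop}
    (hgood : p * Fintype.card U ≤ #{u : U | good u}) {D : ℕ → (κ → U) → Prop}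
    (hc : Set.InjOn c (Set.Iio N)) (hD : ∀ s r, s ≤ r → r < N → DependsOn (D s) {c r}ᶜ) (M : ℕ) :
    (#{ω : κ → U | M ≤ failedTrials (D · ω) (fun s => good (ω (c s))) N} : ℝ) ≤
      (1 - p) ^ M * Fintype.card (κ → U) := by
  set Z : ℕ → (κ → U) → ℝ := fun m ω =>
    failureWeight p M (failedTrials (D · ω) (fun s => good (ω (c s))) m)
      (NoSuccess (D · ω) (fun s => good (ω (c s))) m)
  calc (#{ω : κ → U | M ≤ failedTrials (D · ω) (fun s => good (ω (c s))) N} : ℝ)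
      = ∑ ω, if M ≤ failedTrials (D · ω) (fun s => good (ω (c s))) N then (1 : ℝ) else 0 := by
        simp
    _ ≤ ∑ ω, Z N ω := sum_le_sum fun ω _ => by
        split_ifs with h
        · exact (failureWeight_of_le p h _).ge
        · exact failureWeight_nonneg hp _ _ _
    _ ≤ ∑ ω, Z 0 ω := sum_le_sum_of_sum_update_le fun m hm =>
        sum_failureWeight_update_le hp hgood hc hD M hm
    _ = (1 - p) ^ M * Fintype.card (κ → U) := by
        simp [Z, failureWeight, failedTrials, NoSuccess, mul_comm]

theorem sum_exp_sum_sub_le {Y a : ℕ → (κ → U) → ℝ} {lam : ℝ} (hlam0 : 0 ≤ lam)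
    (hlam1 : lam ≤ 1) (hY0 : ∀ t < N, ∀ ω, 0 ≤ Y t ω) (hY1 : ∀ t < N, ∀ ω, Y t ω ≤ 1)
    (ha : ∀ s t, s ≤ t → t < N → DependsOn (a s) {c t}ᶜ)
    (hY : ∀ s t, s < t → t < N → DependsOn (Y s) {c t}ᶜ)
    (hmean : ∀ t < N, ∀ ω, ∑ u, Y t (update ω (c t) u) ≤ Fintype.card U * a t ω) :
    ∑ ω, Real.exp (lam * ∑ t ∈ range N, (Y t ω - a t ω) - lam ^ 2 * N) ≤
      Fintype.card (κ → U) := by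
  set Z : ℕ → (κ → U) → ℝ := fun m ω =>
    Real.exp (lam * ∑ t ∈ range m, (Y t ω - a t ω) - lam ^ 2 * m) with hZ
  refine (sum_le_sum_of_sum_update_le (c := c) (Z := Z) fun m hm ω => ?_).trans (by simp [hZ])
  have hfactor (u) : Z (m + 1) (update ω (c m) u) =
      Z m ω * Real.exp (-(lam * a m ω + lam ^ 2)) * Real.exp (lam * Y m (update ω (c m) u)) := by
    have hpast : ∑ t ∈ range m, (Y t (update ω (c m) u) - a t (update ω (c m) u)) =
        ∑ t ∈ range m, (Y t ω - a t ω) := sum_congr rfl fun t ht => by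
      have ht := mem_range.1 ht
      rw [apply_update_of_dependsOn (ha t m ht.le hm),
        apply_update_of_dependsOn (hY t m ht hm)]
    simp only [hZ]
    rw [← Real.exp_add, ← Real.exp_add, sum_range_succ,
      apply_update_of_dependsOn (ha m m le_rfl hm), hpast]
    push_cast
    ring_nf
  calc ∑ u, Z (m + 1) (update ω (c m) u)
      = Z m ω * Real.exp (-(lam * a m ω + lam ^ 2)) *
          ∑ u, Real.exp (lam * Y m (update ω (c m) u)) := by
        rw [mul_sum, sum_congr rfl fun u _ => hfactor u]
    _ ≤ Z m ω * Real.exp (-(lam * a m ω + lam ^ 2)) *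
          (Fintype.card U * Real.exp (lam * a m ω + lam ^ 2)) := by
        gcongr
        exact sum_exp_mul_le (fun u => hY0 m hm _) (fun u => hY1 m hm _) (hmean m hm ω) hlam0 hlam1
    _ = Fintype.card U * Z m ω := by
        rw [Real.exp_neg]
        field_simp

theorem card_add_lt_sum_le {Y a : ℕ → (κ → U) → ℝ} {lam : ℝ} (hlam0 : 0 < lam)
    (hlam1 : lam ≤ 1) (hY0 : ∀ t < N, ∀ ω, 0 ≤ Y t ω) (hY1 : ∀ t < N, ∀ ω, Y t ω ≤ 1)
    (ha : ∀ s t, s ≤ t → t < N → DependsOn (a s) {c t}ᶜ)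
    (hY : ∀ s t, s < t → t < N → DependsOn (Y s) {c t}ᶜ)
    (hmean : ∀ t < N, ∀ ω, ∑ u, Y t (update ω (c t) u) ≤ Fintype.card U * a t ω) (r : ℝ) :
    (#{ω : κ → U | ∑ t ∈ range N, a t ω + lam * N + r / lam < ∑ t ∈ range N, Y t ω} : ℝ) ≤
      Real.exp (-r) * Fintype.card (κ → U) := by
  rw [Real.exp_neg, inv_mul_eq_div, le_div_iff₀' (Real.exp_pos r)]
  refine le_trans ?_ (sum_exp_sum_sub_le hlam0.le hlam1 hY0 hY1 ha hY hmean)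
  rw [card_filter, Nat.cast_sum, mul_sum]
  refine sum_le_sum fun ω _ => ?_
  split_ifs with h
  · rw [Nat.cast_one, mul_one, Real.exp_le_exp, sum_sub_distrib]
    have hmul := mul_le_mul_of_nonneg_left h.le hlam0.le
    rw [mul_add, mul_add, mul_div_cancel₀ _ hlam0.ne'] at hmul
    linarith
  · simpa using (Real.exp_pos _).le

end Resampling

/-- An expert in a pool, with its record over the completed epochs since it joined: their number
`age`, its total gain, and the total `bench` of the best gains of the older entries in these epochs.
The field `cur` is its loss so far in the current epoch. -/
@[ext]
structure PoolEntry (n : ℕ) where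
  expert : Fin n
  age : ℕ
  gain : ℕ
  bench : ℕ
  cur : ℕ

namespace PoolEntry

variable {n : ℕ}

/-- The entry of an expert that just joined. -/
def fresh (i : Fin n) : PoolEntry n := ⟨i, 0, 0, 0, 0⟩

/-- The eviction rule: per epoch since the entry joined, the older entries have been at most `R / q`
worse than the entry. -/
def Covered (q R : ℕ) (e : PoolEntry n) : Prop := q * e.gain ≤ q * e.bench + R * e.age

instance (q R : ℕ) : DecidablePred (Covered (n := n) q R) := fun e =>
  inferInstanceAs (Decidable (q * e.gain ≤ q * e.bench + R * e.age))

/-- The entry after an epoch in which it gained `g` and the best older entry gained `b`. -/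
def record (g b : ℕ) (e : PoolEntry n) : PoolEntry n :=
  ⟨e.expert, e.age + 1, e.gain + g, e.bench + b, 0⟩

/-- Add the loss of a day to the loss in the current epoch. -/
def addLoss (l : Fin n → ℕ) (e : PoolEntry n) : PoolEntry n := { e with cur := e.cur + l e.expert }

theorem addLoss_addLoss (l l' : Fin n → ℕ) (e : PoolEntry n) :
    (e.addLoss l).addLoss l' = e.addLoss (fun i => l i + l' i) := by
  simp [addLoss, add_assoc]

theorem map_addLoss_zero (p : List (PoolEntry n)) : p.map (addLoss fun _ => 0) = p :=
  List.map_id p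

end PoolEntry

namespace Pool

open PoolEntry

variable {n : ℕ}

/-- The largest gain in a pool, and `0` for the empty pool. -/
def topGain (g : PoolEntry n → ℕ) (l : List (PoolEntry n)) : ℕ :=
  Multiset.sup ↑(l.map g)

/-- The largest gain in a pool, when expert `i` gains `g i`. -/
abbrev bestGain (g : Fin n → ℕ) : List (PoolEntry n) → ℕ := topGain fun e => g e.expert

/-- The end of an epoch: the records are updated and the covered entries are evicted. The pool is
listed from the youngest to the oldest entry. -/
def closeEpoch (q R : ℕ) (g : PoolEntry n → ℕ) : List (PoolEntry n) → List (PoolEntry n)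
  | [] => []
  | e :: l =>
    if (e.record (g e) (topGain g l)).Covered q R then closeEpoch q R g l
    else e.record (g e) (topGain g l) :: closeEpoch q R g l

@[simp]
theorem topGain_nil (g : PoolEntry n → ℕ) : topGain g [] = 0 := rfl

@[simp]
theorem topGain_cons (g : PoolEntry n → ℕ) (e : PoolEntry n) (l : List (PoolEntry n)) :
    topGain g (e :: l) = max (g e) (topGain g l) := by
  simp [topGain, ← Multiset.cons_coe]

theorem topGain_le_iff {g : PoolEntry n → ℕ} {l : List (PoolEntry n)} {b : ℕ} :
    topGain g l ≤ b ↔ ∀ e ∈ l, g e ≤ b := by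
  rw [topGain, Multiset.sup_le]
  simp

theorem cast_topGain_le {g : PoolEntry n → ℕ} {l : List (PoolEntry n)} {b : ℝ} (hb : 0 ≤ b)
    (h : ∀ e ∈ l, (g e : ℝ) ≤ b) : (topGain g l : ℝ) ≤ b :=
  (Nat.le_floor_iff hb).1 (topGain_le_iff.2 fun e he => Nat.le_floor (h e he))

theorem le_topGain (g : PoolEntry n → ℕ) {l : List (PoolEntry n)} {e : PoolEntry n} (he : e ∈ l) :
    g e ≤ topGain g l :=
  topGain_le_iff.1 le_rfl e he

theorem topGain_mono (g : PoolEntry n → ℕ) {l l' : List (PoolEntry n)} (h : l ⊆ l') :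
    topGain g l ≤ topGain g l' :=
  topGain_le_iff.2 fun _ he => le_topGain g (h he)

theorem topGain_congr {g g' : PoolEntry n → ℕ} {l : List (PoolEntry n)}
    (h : ∀ e ∈ l, g e = g' e) : topGain g l = topGain g' l := by
  rw [topGain, topGain, List.map_congr_left h]

theorem topGain_map (g : PoolEntry n → ℕ) (f : PoolEntry n → PoolEntry n)
    (l : List (PoolEntry n)) : topGain g (l.map f) = topGain (fun e => g (f e)) l := by
  simp [topGain, Function.comp_def]

theorem closeEpoch_map (q R : ℕ) (g : PoolEntry n → ℕ) {f : PoolEntry n → PoolEntry n}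
    (hf : ∀ e a b, (f e).record a b = e.record a b) (l : List (PoolEntry n)) :
    closeEpoch q R g (l.map f) = closeEpoch q R (fun e => g (f e)) l := by
  induction l with
  | nil => rfl
  | cons a l ih => simp only [List.map_cons, closeEpoch, topGain_map, hf, ih]

theorem closeEpoch_congr (q R : ℕ) {g g' : PoolEntry n → ℕ} {l : List (PoolEntry n)}
    (h : ∀ e ∈ l, g e = g' e) : closeEpoch q R g l = closeEpoch q R g' l := by
  induction l with
  | nil => rfl
  | cons a l ih =>
    obtain ⟨ha, hl⟩ := List.forall_mem_cons.1 h
    simp only [closeEpoch, ha, ih hl, topGain_congr hl]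

theorem mem_closeEpoch {q R : ℕ} {g : PoolEntry n → ℕ} {l : List (PoolEntry n)} {e : PoolEntry n}
    (he : e ∈ closeEpoch q R g l) :
    ¬ e.Covered q R ∧ ∃ e₀ ∈ l, ∃ b ≤ topGain g l, e = e₀.record (g e₀) b := by
  induction l with
  | nil => simp [closeEpoch] at he
  | cons a l ih =>
    have hold (h : e ∈ closeEpoch q R g l) : ¬ e.Covered q R ∧ ∃ e₀ ∈ a :: l,
        ∃ b ≤ topGain g (a :: l), e = e₀.record (g e₀) b := by
      obtain ⟨hcov, e₀, he₀, b, hb, rfl⟩ := ih h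
      exact ⟨hcov, e₀, List.mem_cons_of_mem _ he₀, b, hb.trans (by simp), rfl⟩
    rw [closeEpoch] at he
    split_ifs at he with h
    · exact hold he
    · rcases List.mem_cons.1 he with rfl | he
      · exact ⟨h, a, List.mem_cons_self, _, by simp, rfl⟩
      · exact hold he

theorem closeEpoch_suffix (q R : ℕ) (g : PoolEntry n → ℕ) {l l' : List (PoolEntry n)}
    (h : l <:+ l') : closeEpoch q R g l <:+ closeEpoch q R g l' := by
  obtain ⟨y, rfl⟩ := h
  induction y with
  | nil => exact List.suffix_rfl
  | cons a y ih =>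
    rw [List.cons_append, closeEpoch]
    split_ifs
    · exact ih
    · exact ih.trans (List.suffix_cons _ _)

theorem bestGain_closeEpoch_le (q R : ℕ) (g : PoolEntry n → ℕ) (h : Fin n → ℕ)
    (l : List (PoolEntry n)) : bestGain h (closeEpoch q R g l) ≤ bestGain h l := by
  refine topGain_le_iff.2 fun e he => ?_
  obtain ⟨-, e₀, he₀, b, -, rfl⟩ := mem_closeEpoch he
  exact le_topGain (fun e => h e.expert) (e := e₀) he₀

section Dynamics

variable (q R : ℕ) (G : ℕ → Fin n → ℕ) (X : ℕ → Fin n)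

/-- The pool at the beginning of epoch `s`, before the expert of this epoch joins, when expert `i`
has gain `G s i` in epoch `s` and `X s` joins at the beginning of epoch `s`. -/
def older : ℕ → List (PoolEntry n)
  | 0 => []
  | s + 1 => closeEpoch q R (fun e => G s e.expert) (fresh (X s) :: older s)

/-- The pool during epoch `s`. -/
def pool (s : ℕ) : List (PoolEntry n) := fresh (X s) :: older q R G X s

/-- What becomes of the part `l` of the pool in the `r` epochs from `s` on. -/
def evolve (s : ℕ) (l : List (PoolEntry n)) : ℕ → List (PoolEntry n)
  | 0 => l
  | r + 1 => closeEpoch q R (fun e => G (s + r) e.expert) (evolve s l r)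

/-- In the epochs `s, …, s + r` the entries older than `s` did almost as well as expert `i`. -/
def CoveredUpTo (i : Fin n) (s r : ℕ) : Prop :=
  q * ∑ τ ∈ range (r + 1), G (s + τ) i ≤
    q * ∑ τ ∈ range (r + 1), bestGain (G (s + τ)) (evolve q R G s (older q R G X s) τ) + R * (r + 1)

open scoped Classical in
/-- The epoch after an interval of epochs before `N`, starting with `s`, in which the older entries
cover expert `i`; if there is none, epoch `s` is left uncovered. -/
noncomputable def nextStart (i : Fin n) (N s : ℕ) : ℕ :=
  if h : ∃ r, s + r < N ∧ CoveredUpTo q R G X i s r then s + h.choose + 1 else s + 1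

/-- The time axis is scanned from the left and split greedily into covering intervals and single
uncovered epochs. This is the end of what is split by the pieces that start before epoch `s`. -/
noncomputable def coverEnd (i : Fin n) (N : ℕ) : ℕ → ℕ
  | 0 => 0
  | s + 1 => if coverEnd i N s = s then nextStart q R G X i N s else coverEnd i N s

/-- Epoch `s` is uncovered, and expert `i` would not be evicted before `N` if it joined now. -/
def Trial (i : Fin n) (N s : ℕ) : Prop :=
  s < N ∧ coverEnd q R G X i N s = s ∧ ∀ r, s + r < N → ¬ CoveredUpTo q R G X i s r

/-- The number of trials for expert `i` that pass before it joins in a trial. -/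
noncomputable def failures (i : Fin n) (N : ℕ) : ℕ :=
  failedTrials (Trial q R G X i N) (X · = i) N

theorem older_congr {X' : ℕ → Fin n} {s : ℕ} (h : ∀ r < s, X r = X' r) :
    older q R G X s = older q R G X' s := by
  induction s with
  | zero => rfl
  | succ s ih => rw [older, older, h s (by omega), ih fun r hr => h r (by omega)]

theorem coveredUpTo_congr {X' : ℕ → Fin n} {s : ℕ} (h : ∀ r < s, X r = X' r) (i : Fin n) :
    CoveredUpTo q R G X i s = CoveredUpTo q R G X' i s := by
  funext r
  rw [CoveredUpTo, CoveredUpTo, older_congr q R G X h]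

theorem coverEnd_congr {X' : ℕ → Fin n} {s : ℕ} (h : ∀ r < s, X r = X' r) (i : Fin n) (N : ℕ) :
    coverEnd q R G X i N s = coverEnd q R G X' i N s := by
  induction s with
  | zero => rfl
  | succ s ih =>
    have h' : ∀ r < s, X r = X' r := fun r hr => h r (by omega)
    have hnext : nextStart q R G X i N s = nextStart q R G X' i N s := by
      rw [nextStart, nextStart, coveredUpTo_congr q R G X h' i]
    rw [coverEnd, coverEnd, ih h', hnext]

theorem trial_congr {X' : ℕ → Fin n} {s : ℕ} (h : ∀ r < s, X r = X' r) (i : Fin n) (N : ℕ) :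
    Trial q R G X i N s = Trial q R G X' i N s := by
  simp only [Trial, coverEnd_congr q R G X h, coveredUpTo_congr q R G X h]

theorem evolve_suffix_pool {s : ℕ} {l : List (PoolEntry n)} (hl : l <:+ pool q R G X s) (r : ℕ) :
    evolve q R G s l r <:+ pool q R G X (s + r) := by
  induction r with
  | zero => exact hl
  | succ r ih => exact (closeEpoch_suffix q R _ ih).trans (List.suffix_cons _ _)

theorem evolve_fresh_cons {i : Fin n} {s H : ℕ} (h : ∀ r < H, ¬ CoveredUpTo q R G X i s r) :
    evolve q R G s (fresh i :: older q R G X s) H =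
      ⟨i, H, ∑ τ ∈ range H, G (s + τ) i,
        ∑ τ ∈ range H, bestGain (G (s + τ)) (evolve q R G s (older q R G X s) τ), 0⟩ ::
      evolve q R G s (older q R G X s) H := by
  induction H with
  | zero => simp [evolve, fresh]
  | succ r ih =>
    have hr := h r (by omega)
    simp only [CoveredUpTo, sum_range_succ _ r] at hr
    rw [evolve, ih fun r' hr' => h r' (by omega), closeEpoch, if_neg]
    · simp only [evolve, record, sum_range_succ _ r]
    · simpa only [Covered, record] using hr

theorem gain_le_bestGain_pool {i : Fin n} {s N : ℕ} (hX : X s = i)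
    (h : ∀ r, s + r < N → ¬ CoveredUpTo q R G X i s r) {r : ℕ} (hr : s + r < N) :
    G (s + r) i ≤ bestGain (G (s + r)) (pool q R G X (s + r)) := by
  have hsuffix := evolve_suffix_pool q R G X (l := fresh i :: older q R G X s)
    (by rw [pool, hX]) r
  rw [evolve_fresh_cons q R G X fun r' hr' => h r' (by omega)] at hsuffix
  exact le_topGain (fun e => G (s + r) e.expert) (hsuffix.subset List.mem_cons_self)

theorem coverEnd_succ_of_ne {i : Fin n} {N s : ℕ} (h : coverEnd q R G X i N s ≠ s) :
    coverEnd q R G X i N (s + 1) = coverEnd q R G X i N s :=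
  if_neg h

theorem coverEnd_succ_of_not_covered {i : Fin n} {N s : ℕ} (h : coverEnd q R G X i N s = s)
    (hcov : ¬ ∃ r, s + r < N ∧ CoveredUpTo q R G X i s r) :
    coverEnd q R G X i N (s + 1) = s + 1 := by
  rw [coverEnd, if_pos h, nextStart, dif_neg hcov]

theorem exists_coverEnd_succ {i : Fin n} {N s : ℕ} (h : coverEnd q R G X i N s = s)
    (hcov : ∃ r, s + r < N ∧ CoveredUpTo q R G X i s r) :
    ∃ r, s + r < N ∧ CoveredUpTo q R G X i s r ∧ coverEnd q R G X i N (s + 1) = s + (r + 1) := by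
  refine ⟨hcov.choose, hcov.choose_spec.1, hcov.choose_spec.2, ?_⟩
  rw [coverEnd, if_pos h, nextStart, dif_pos hcov, add_assoc]

theorem coverEnd_mem_Icc (i : Fin n) {N s : ℕ} (hs : s ≤ N) :
    coverEnd q R G X i N s ∈ Set.Icc s N := by
  rw [Set.mem_Icc]
  induction s with
  | zero => simp [coverEnd]
  | succ s ih =>
    by_cases h : coverEnd q R G X i N s = s
    · by_cases hcov : ∃ r, s + r < N ∧ CoveredUpTo q R G X i s r
      · obtain ⟨r, hr, -, heq⟩ := exists_coverEnd_succ q R G X h hcov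
        omega
      · have := coverEnd_succ_of_not_covered q R G X h hcov
        omega
    · have := coverEnd_succ_of_ne q R G X h
      omega

theorem sum_gain_coverEnd_le {i : Fin n} {N : ℕ} (hG : ∀ s, G s i ≤ R) {s : ℕ} (hs : s ≤ N)
    (hfail : NoSuccess (Trial q R G X i N) (X · = i) s) :
    q * ∑ τ ∈ range (coverEnd q R G X i N s), G τ i ≤
      q * ∑ τ ∈ range (coverEnd q R G X i N s), bestGain (G τ) (pool q R G X τ) +
        R * coverEnd q R G X i N s + q * R * failedTrials (Trial q R G X i N) (X · = i) s := by
  induction s with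
  | zero => simp [coverEnd]
  | succ s ih =>
    have ih := ih (by omega) (noSuccess_succ.1 hfail).1
    have hmono := Nat.mul_le_mul_left (q * R)
      (monotone_failedTrials (D := Trial q R G X i N) (hit := (X · = i)) (Nat.le_add_right s 1))
    by_cases hend : coverEnd q R G X i N s = s
    · rw [hend] at ih
      by_cases hcov : ∃ r, s + r < N ∧ CoveredUpTo q R G X i s r
      · obtain ⟨r, -, hr, heq⟩ := exists_coverEnd_succ q R G X hend hcov
        rw [heq, sum_range_add _ s (r + 1), sum_range_add _ s (r + 1)]
        have hpool : ∑ τ ∈ range (r + 1),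
              bestGain (G (s + τ)) (evolve q R G s (older q R G X s) τ) ≤
            ∑ τ ∈ range (r + 1), bestGain (G (s + τ)) (pool q R G X (s + τ)) :=
          sum_le_sum fun τ _ => topGain_mono _
            (evolve_suffix_pool q R G X (List.suffix_cons _ _) τ).subset
        have := Nat.mul_le_mul_left q hpool
        rw [CoveredUpTo] at hr
        nlinarith
      · have htrial : Trial q R G X i N s := ⟨hs, hend, fun r hr hcr => hcov ⟨r, hr, hcr⟩⟩
        rw [coverEnd_succ_of_not_covered q R G X hend hcov, sum_range_succ, sum_range_succ,
          failedTrials_succ_of_fail htrial hfail]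
        have := Nat.mul_le_mul_left q (hG s)
        nlinarith
    · rw [coverEnd_succ_of_ne q R G X hend]
      omega

/-- Before the first success of a trial, the covering intervals cost only the slack of the eviction
rule and every other epoch is a failed trial; after it, expert `i` stays in the pool. -/
theorem sum_gain_le {i : Fin n} (hG : ∀ s, G s i ≤ R) (N : ℕ) :
    q * ∑ τ ∈ range N, G τ i ≤ q * ∑ τ ∈ range N, bestGain (G τ) (pool q R G X τ) +
      R * N + q * R * failures q R G X i N := by
  classical
  by_cases hfail : NoSuccess (Trial q R G X i N) (X · = i) N
  · have hend := coverEnd_mem_Icc q R G X i (le_refl N)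
    simpa only [le_antisymm hend.2 hend.1, failures] using
      sum_gain_coverEnd_le q R G X hG le_rfl hfail
  · have hsuccess : ∃ s < N, Trial q R G X i N s ∧ X s = i := by
      simpa [NoSuccess] using hfail
    obtain ⟨hs, htrial, hX⟩ := Nat.find_spec hsuccess
    have hfirst : NoSuccess (Trial q R G X i N) (X · = i) (Nat.find hsuccess) :=
      fun r hr ht hx => Nat.find_min hsuccess hr ⟨by omega, ht, hx⟩
    generalize Nat.find hsuccess = s at hs htrial hX hfirst
    have hbefore := sum_gain_coverEnd_le q R G X hG hs.le hfirst
    rw [htrial.2.1] at hbefore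
    have hmono := Nat.mul_le_mul_left (q * R)
      (monotone_failedTrials (D := Trial q R G X i N) (hit := (X · = i)) hs.le)
    obtain ⟨d, rfl⟩ := Nat.exists_eq_add_of_le hs.le
    have hafter : ∑ τ ∈ range d, G (s + τ) i ≤
        ∑ τ ∈ range d, bestGain (G (s + τ)) (pool q R G X (s + τ)) :=
      sum_le_sum fun τ hτ => gain_le_bestGain_pool q R G X hX htrial.2.2
        (Nat.add_lt_add_left (mem_range.1 hτ) s)
    rw [sum_range_add, sum_range_add, failures]
    have := Nat.mul_le_mul_left q hafter
    nlinarith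

/-- The records of the pool `l` are correct at the beginning of epoch `s`. Since the entries older
than a given one may be evicted later on, `bench` is only bounded below. -/
def Tracks (s : ℕ) : List (PoolEntry n) → Prop
  | [] => True
  | e :: l => e.age ≤ s ∧ e.gain = ∑ τ ∈ Ico (s - e.age) s, G τ e.expert ∧
      ∑ τ ∈ Ico (s - e.age) s, bestGain (G τ) l ≤ e.bench ∧ Tracks s l

variable {G}

theorem tracks_closeEpoch {s : ℕ} {l : List (PoolEntry n)} (h : Tracks G s l) :
    Tracks G (s + 1) (closeEpoch q R (fun e => G s e.expert) l) := by
  induction l with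
  | nil => trivial
  | cons e l ih =>
    obtain ⟨hage, hgain, hbench, hl⟩ := h
    rw [closeEpoch]
    split_ifs
    · exact ih hl
    · refine ⟨by simpa [record] using hage, ?_, ?_, ih hl⟩ <;>
        simp only [record, Nat.reduceSubDiff] <;> rw [sum_Ico_succ_top (by omega)]
      · rw [hgain]
      · exact add_le_add ((sum_le_sum fun τ _ => bestGain_closeEpoch_le q R _ (G τ) l).trans hbench)
          (bestGain_closeEpoch_le q R _ (G s) l)

theorem tracks_older (s : ℕ) : Tracks G s (older q R G X s) := by
  induction s with
  | zero => trivial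
  | succ s ih =>
    exact tracks_closeEpoch q R ⟨by simp [fresh], by simp [fresh], by simp [fresh], ih⟩

variable {q R}

/-- An uncovered entry of age `a` exceeded the best older entry by `R / q` per epoch on average over
the last `a` epochs, and `1 / a ≤ 1 / (s - τ)` for each such epoch `τ`. -/
theorem le_sum_bestGain_sub_div {s : ℕ} {e : PoolEntry n} {l : List (PoolEntry n)}
    (h : Tracks G s (e :: l)) (he : ¬ e.Covered q R) :
    (R : ℝ) ≤ q * ∑ τ ∈ range s,
      ((bestGain (G τ) (e :: l) : ℝ) - bestGain (G τ) l) / ((s - τ : ℕ) : ℝ) := by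
  obtain ⟨-, hgain, hbench, -⟩ := h
  rw [Covered, not_le] at he
  have hage : 0 < e.age := by
    rcases Nat.eq_zero_or_pos e.age with h0 | h0
    · simp [hgain, h0] at he
    · exact h0
  have hexcess (τ) : (0 : ℝ) ≤ (bestGain (G τ) (e :: l) : ℝ) - bestGain (G τ) l :=
    sub_nonneg.2 (by exact_mod_cast topGain_mono _ (List.subset_cons_self _ _))
  have havg : (R : ℝ) ≤ q * ((e.gain - e.bench) / e.age) := by
    have : (q : ℝ) * e.bench + R * e.age ≤ q * e.gain := by exact_mod_cast he.le
    rw [← mul_div_assoc, le_div_iff₀ (by exact_mod_cast hage)]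
    linarith
  refine havg.trans (mul_le_mul_of_nonneg_left ?_ q.cast_nonneg)
  calc ((e.gain : ℝ) - e.bench) / e.age
      ≤ (∑ τ ∈ Ico (s - e.age) s, ((G τ e.expert : ℝ) - bestGain (G τ) l)) / e.age := by
        have : ∑ τ ∈ Ico (s - e.age) s, (bestGain (G τ) l : ℝ) ≤ e.bench := by exact_mod_cast hbench
        rw [sum_sub_distrib, hgain, Nat.cast_sum]
        gcongr
    _ ≤ ∑ τ ∈ Ico (s - e.age) s,
          ((bestGain (G τ) (e :: l) : ℝ) - bestGain (G τ) l) / ((s - τ : ℕ) : ℝ) := by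
        rw [sum_div]
        refine sum_le_sum fun τ hτ => ?_
        have hτ := mem_Ico.1 hτ
        have hG : G τ e.expert ≤ bestGain (G τ) (e :: l) :=
          le_topGain (fun e => G τ e.expert) List.mem_cons_self
        have hpos : (0 : ℝ) < (s - τ : ℕ) := by exact_mod_cast (by omega : 0 < s - τ)
        exact div_le_div₀ (hexcess τ) (by gcongr) hpos
          (by exact_mod_cast (by omega : s - τ ≤ e.age))
    _ ≤ _ := sum_le_sum_of_subset_of_nonneg (fun τ hτ => mem_range.2 (mem_Ico.1 hτ).2)
        fun τ _ _ => div_nonneg (hexcess τ) (Nat.cast_nonneg _)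

theorem length_mul_le_of_tracks {s : ℕ} {l : List (PoolEntry n)} (h : Tracks G s l)
    (hl : ∀ e ∈ l, ¬ e.Covered q R) :
    (l.length : ℝ) * R ≤ q * ∑ τ ∈ range s, (bestGain (G τ) l : ℝ) / ((s - τ : ℕ) : ℝ) := by
  induction l with
  | nil => simp
  | cons e l ih =>
    obtain ⟨he, hl⟩ := List.forall_mem_cons.1 hl
    have hyoungest := le_sum_bestGain_sub_div h he
    simp only [sub_div, sum_sub_distrib, mul_sub] at hyoungest
    rw [List.length_cons]
    push_cast
    linarith [ih h.2.2.2 hl]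

theorem sum_inv_sub_le {s N : ℕ} (hs : s ≤ N) :
    ∑ τ ∈ range s, (((s - τ : ℕ) : ℝ))⁻¹ ≤ 1 + Real.log N := by
  calc ∑ τ ∈ range s, (((s - τ : ℕ) : ℝ))⁻¹ = ∑ τ ∈ range s, ((τ + 1 : ℕ) : ℝ)⁻¹ := by
        rw [← sum_range_reflect]
        refine sum_congr rfl fun τ hτ => ?_
        have := mem_range.1 hτ
        rw [show s - (s - 1 - τ) = τ + 1 by omega]
    _ ≤ ∑ τ ∈ range N, ((τ + 1 : ℕ) : ℝ)⁻¹ := by gcongr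
    _ = harmonic N := by simp [harmonic]
    _ ≤ 1 + Real.log N := harmonic_le_one_add_log N

variable (q R)

theorem not_covered_of_mem_older {s : ℕ} {e : PoolEntry n} (he : e ∈ older q R G X s) :
    ¬ e.Covered q R := by
  cases s with
  | zero => simp [older] at he
  | succ s => exact (mem_closeEpoch he).1

theorem length_older_le (hR : 0 < R) (hG : ∀ s i, G s i ≤ R) {s N : ℕ} (hs : s ≤ N) :
    ((older q R G X s).length : ℝ) ≤ q * (1 + Real.log N) := by
  have hR' : (0 : ℝ) < R := by exact_mod_cast hR
  refine le_of_mul_le_mul_right ?_ hR'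
  calc ((older q R G X s).length : ℝ) * R
      ≤ q * ∑ τ ∈ range s, (bestGain (G τ) (older q R G X s) : ℝ) / ((s - τ : ℕ) : ℝ) :=
        length_mul_le_of_tracks (tracks_older q R X s) fun e he =>
          not_covered_of_mem_older q R X he
    _ ≤ q * ∑ τ ∈ range s, (R : ℝ) * (((s - τ : ℕ) : ℝ))⁻¹ := by
        simp only [div_eq_mul_inv]
        gcongr
        exact topGain_le_iff.2 fun e _ => hG _ e.expert
    _ ≤ q * (R * (1 + Real.log N)) := by
        rw [← mul_sum]
        gcongr
        exact sum_inv_sub_le hs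
    _ = q * (1 + Real.log N) * R := by ring

theorem records_le_of_mem_pool (hG : ∀ s i, G s i ≤ R) {s : ℕ} {e : PoolEntry n}
    (he : e ∈ pool q R G X s) : e.age ≤ s ∧ e.gain ≤ s * R ∧ e.bench ≤ s * R := by
  induction s generalizing e with
  | zero =>
    obtain rfl : e = fresh (X 0) := by simpa [pool, older] using he
    simp [fresh]
  | succ s ih =>
    rcases List.mem_cons.1 he with rfl | he
    · simp [fresh]
    · obtain ⟨-, e₀, he₀, b, hb, rfl⟩ := mem_closeEpoch he
      have hb : b ≤ R := hb.trans (topGain_le_iff.2 fun e _ => hG s e.expert)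
      have hg := hG s e₀.expert
      obtain ⟨hage, hgain, hbench⟩ := ih he₀
      refine ⟨?_, ?_, ?_⟩ <;> simp only [record] <;> linarith

end Dynamics

end Pool

/-- The state of one level: the loss of the level below in the current epoch, and the pool. -/
@[ext]
structure LevelState (n : ℕ) where
  lower : ℕ
  pool : List (PoolEntry n)

namespace LevelState

open PoolEntry Pool

variable {n : ℕ}

/-- The weight that exponential weights with learning rate `η` gives to total loss `c`. -/
noncomputable def weight (η : ℝ) (c : ℕ) : ℝ := Real.exp (-(η * c))

/-- The total weight of the level below and the experts in the pool. -/
noncomputable def norm (η : ℝ) (s : LevelState n) : ℝ :=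
  weight η s.lower + (s.pool.map fun e => weight η e.cur).sum

/-- The loss of the exponential weights algorithm on a day on which the level below has loss `a`
and expert `i` has loss `l i`. -/
noncomputable def mixedLoss (η : ℝ) (s : LevelState n) (a : ℝ) (l : Fin n → ℝ) : ℝ :=
  (weight η s.lower * a + (s.pool.map fun e => weight η e.cur * l e.expert).sum) / s.norm η

/-- The loss of the exponential weights algorithm, rounded up so that it can be stored. -/
noncomputable def loss (η : ℝ) (s : LevelState n) (a : ℕ) (l : Fin n → ℕ) : ℕ :=
  ⌈s.mixedLoss η a (fun i => l i)⌉₊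

/-- Add the losses of a day. -/
def accumulate (a : ℕ) (l : Fin n → ℕ) (s : LevelState n) : LevelState n :=
  ⟨s.lower + a, s.pool.map (addLoss l)⟩

/-- The state after `r` days of an epoch that starts on day `d` with pool `p`. -/
def during (a : ℕ → ℕ) (l : ℕ → Fin n → ℕ) (d : ℕ) (p : List (PoolEntry n)) (r : ℕ) :
    LevelState n :=
  ⟨∑ k ∈ range r, a (d + k), p.map (addLoss fun i => ∑ k ∈ range r, l (d + k) i)⟩

/-- The regret of exponential weights with `m` options over `E` days, when the losses are at most
`Q` and rounded up. -/
noncomputable def hedgeRegret (η : ℝ) (Q E : ℕ) (m : ℝ) : ℝ :=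
  Real.log m / η + E * (η * Q ^ 2 + 1)

theorem weight_pos (η : ℝ) (c : ℕ) : 0 < weight η c := Real.exp_pos _

theorem sum_weight_nonneg (η : ℝ) (p : List (PoolEntry n)) :
    0 ≤ (p.map fun e => weight η e.cur).sum :=
  List.sum_nonneg (by simpa using fun (e : PoolEntry n) _ => (weight_pos η e.cur).le)

theorem weight_lower_le_norm (η : ℝ) (s : LevelState n) : weight η s.lower ≤ s.norm η :=
  le_add_of_nonneg_right (sum_weight_nonneg η s.pool)

theorem weight_cur_le_norm (η : ℝ) (s : LevelState n) {e : PoolEntry n} (he : e ∈ s.pool) :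
    weight η e.cur ≤ s.norm η :=
  (List.single_le_sum (by simpa using fun (e : PoolEntry n) _ => (weight_pos η e.cur).le) _
    (List.mem_map_of_mem (f := fun e => weight η e.cur) he)).trans
    (le_add_of_nonneg_left (weight_pos η s.lower).le)

theorem norm_pos (η : ℝ) (s : LevelState n) : 0 < s.norm η :=
  (weight_pos η s.lower).trans_le (weight_lower_le_norm η s)

theorem mixedLoss_mul_norm (η : ℝ) (s : LevelState n) (a : ℝ) (l : Fin n → ℝ) :
    s.mixedLoss η a l * s.norm η =
      weight η s.lower * a + (s.pool.map fun e => weight η e.cur * l e.expert).sum :=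
  div_mul_cancel₀ _ (norm_pos η s).ne'

theorem mixedLoss_mono (η : ℝ) (s : LevelState n) {a b : ℝ} (hab : a ≤ b) (l : Fin n → ℝ) :
    s.mixedLoss η a l ≤ s.mixedLoss η b l := by
  have hnorm := (norm_pos η s).le
  have hweight := (weight_pos η s.lower).le
  unfold mixedLoss
  gcongr

theorem mixedLoss_le (η : ℝ) (s : LevelState n) {a Q : ℝ} {l : Fin n → ℝ} (ha : a ≤ Q)
    (hl : ∀ i, l i ≤ Q) : s.mixedLoss η a l ≤ Q := by
  rw [mixedLoss, div_le_iff₀' (norm_pos η s), norm, add_mul, ← List.sum_map_mul_right]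
  refine add_le_add (mul_le_mul_of_nonneg_left ha (weight_pos η s.lower).le) ?_
  exact List.sum_le_sum fun e _ =>
    mul_le_mul_of_nonneg_left (hl e.expert) (weight_pos η e.cur).le

theorem loss_le (η : ℝ) (s : LevelState n) {a Q : ℕ} {l : Fin n → ℕ} (ha : a ≤ Q)
    (hl : ∀ i, l i ≤ Q) : s.loss η a l ≤ Q :=
  Nat.ceil_le.2 (mixedLoss_le η s (by exact_mod_cast ha) fun i => by exact_mod_cast hl i)

theorem mixedLoss_nonneg (η : ℝ) (s : LevelState n) {a : ℝ} {l : Fin n → ℝ} (ha : 0 ≤ a)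
    (hl : ∀ i, 0 ≤ l i) : 0 ≤ s.mixedLoss η a l := by
  refine div_nonneg (add_nonneg (mul_nonneg (weight_pos η _).le ha) ?_) (norm_pos η s).le
  refine List.sum_nonneg ?_
  simpa using fun (e : PoolEntry n) _ => mul_nonneg (weight_pos η e.cur).le (hl e.expert)

theorem loss_le_mixedLoss_add_one (η : ℝ) (s : LevelState n) (a : ℕ) (l : Fin n → ℕ) :
    (s.loss η a l : ℝ) ≤ s.mixedLoss η a (fun i => l i) + 1 :=
  (Nat.ceil_lt_add_one (mixedLoss_nonneg η s a.cast_nonneg fun i => (l i).cast_nonneg)).le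

theorem weight_add_le {η : ℝ} {Q : ℕ} (hη : 0 ≤ η) (hηQ : η * Q ≤ 1) (c : ℕ) {x : ℕ}
    (hx : x ≤ Q) :
    weight η (c + x) ≤ weight η c * (1 + (η * Q) ^ 2) - η * (weight η c * x) := by
  have hx' : η * x ≤ η * Q := mul_le_mul_of_nonneg_left (by exact_mod_cast hx) hη
  have hexp : Real.exp (-(η * x)) ≤ 1 + -(η * x) + (η * Q) ^ 2 :=
    exp_le_one_add_add_sq (by rwa [abs_neg, abs_of_nonneg (by positivity)]) hηQ
  calc weight η (c + x) = weight η c * Real.exp (-(η * x)) := by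
        rw [weight, weight, ← Real.exp_add]
        push_cast
        ring_nf
    _ ≤ weight η c * (1 + -(η * x) + (η * Q) ^ 2) :=
        mul_le_mul_of_nonneg_left hexp (weight_pos η c).le
    _ = _ := by ring

theorem sum_weight_addLoss_le {η : ℝ} {Q : ℕ} (hη : 0 ≤ η) (hηQ : η * Q ≤ 1)
    (p : List (PoolEntry n)) {l : Fin n → ℕ} (hl : ∀ i, l i ≤ Q) :
    ((p.map (addLoss l)).map fun e => weight η e.cur).sum ≤
      (p.map fun e => weight η e.cur).sum * (1 + (η * Q) ^ 2) -
        η * (p.map fun e => weight η e.cur * (l e.expert : ℝ)).sum := by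
  induction p with
  | nil => simp
  | cons e p ih =>
    have he : weight η (e.addLoss l).cur ≤ _ := weight_add_le hη hηQ e.cur (hl e.expert)
    simp only [List.map_cons, List.sum_cons]
    linarith

theorem norm_accumulate_le {η : ℝ} {Q : ℕ} (hη : 0 ≤ η) (hηQ : η * Q ≤ 1) (s : LevelState n)
    {a : ℕ} {l : Fin n → ℕ} (ha : a ≤ Q) (hl : ∀ i, l i ≤ Q) :
    (s.accumulate a l).norm η ≤
      s.norm η * Real.exp (-(η * s.mixedLoss η a (fun i => l i)) + (η * Q) ^ 2) := by
  have hnorm := (norm_pos η s).le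
  calc (s.accumulate a l).norm η
      ≤ s.norm η * (1 + (η * Q) ^ 2) - η * (s.mixedLoss η a (fun i => l i) * s.norm η) := by
        have hlower := weight_add_le hη hηQ s.lower ha
        have hpool := sum_weight_addLoss_le hη hηQ s.pool hl
        rw [mixedLoss_mul_norm, norm, norm, accumulate]
        linarith
    _ = s.norm η * (-(η * s.mixedLoss η a (fun i => l i)) + (η * Q) ^ 2 + 1) := by ring
    _ ≤ _ := by
        gcongr
        exact Real.add_one_le_exp _

theorem accumulate_during (a : ℕ → ℕ) (l : ℕ → Fin n → ℕ) (d : ℕ) (p : List (PoolEntry n))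
    (r : ℕ) : (during a l d p r).accumulate (a (d + r)) (l (d + r)) = during a l d p (r + 1) := by
  simp only [during, accumulate, sum_range_succ, List.map_map]
  congr 1
  exact List.map_congr_left fun e _ => addLoss_addLoss _ _ e

theorem during_zero (a : ℕ → ℕ) (l : ℕ → Fin n → ℕ) (d : ℕ) (p : List (PoolEntry n)) :
    during a l d p 0 = ⟨0, p⟩ := by
  simp [during, map_addLoss_zero]

theorem norm_during_zero (η : ℝ) (a : ℕ → ℕ) (l : ℕ → Fin n → ℕ) (d : ℕ)
    {p : List (PoolEntry n)} (hp : ∀ e ∈ p, e.cur = 0) :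
    (during a l d p 0).norm η = p.length + 1 := by
  have hone : p.map (fun e => weight η e.cur) = p.map fun _ => 1 :=
    List.map_congr_left fun e he => by simp [weight, hp e he]
  rw [during_zero, norm, hone]
  simp [weight, add_comm]

theorem mul_sum_loss_during_le {η : ℝ} {Q : ℕ} (hη : 0 ≤ η) (hηQ : η * Q ≤ 1) {a : ℕ → ℕ}
    {l : ℕ → Fin n → ℕ} (ha : ∀ t, a t ≤ Q) (hl : ∀ t i, l t i ≤ Q) (d : ℕ)
    (p : List (PoolEntry n)) (r : ℕ) :
    η * (∑ k ∈ range r, (during a l d p k).loss η (a (d + k)) (l (d + k)) : ℝ) ≤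
      Real.log ((during a l d p 0).norm η) - Real.log ((during a l d p r).norm η) +
        r * ((η * Q) ^ 2 + η) := by
  induction r with
  | zero => simp
  | succ r ih =>
    have hnorm := norm_accumulate_le hη hηQ (during a l d p r) (ha (d + r)) (hl (d + r))
    rw [accumulate_during] at hnorm
    have hlog := Real.log_le_log (norm_pos η _) hnorm
    rw [Real.log_mul (norm_pos η _).ne' (Real.exp_pos _).ne', Real.log_exp] at hlog
    have hround := mul_le_mul_of_nonneg_left
      (loss_le_mixedLoss_add_one η (during a l d p r) (a (d + r)) (l (d + r))) hη
    rw [sum_range_succ, mul_add]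
    push_cast
    linarith

theorem sum_loss_during_le {η : ℝ} {Q E : ℕ} (hη : 0 < η) (hηQ : η * Q ≤ 1) {a : ℕ → ℕ}
    {l : ℕ → Fin n → ℕ} (ha : ∀ t, a t ≤ Q) (hl : ∀ t i, l t i ≤ Q) {d : ℕ}
    {p : List (PoolEntry n)} (hp : ∀ e ∈ p, e.cur = 0) {c : ℕ}
    (hc : weight η c ≤ (during a l d p E).norm η) :
    (∑ k ∈ range E, (during a l d p k).loss η (a (d + k)) (l (d + k)) : ℝ) ≤
      c + hedgeRegret η Q E (p.length + 1) := by
  have hpotential := mul_sum_loss_during_le hη.le hηQ ha hl d p E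
  have hlog := Real.log_le_log (weight_pos η c) hc
  rw [weight, Real.log_exp] at hlog
  rw [norm_during_zero η a l d hp] at hpotential
  refine le_of_mul_le_mul_left ?_ hη
  rw [hedgeRegret, mul_add, mul_add, mul_div_cancel₀ _ hη.ne']
  linarith

/-- The gain of an entry, at the end of an epoch, over the level below; it is cut off at `R`. -/
def entryGain (R : ℕ) (s : LevelState n) (e : PoolEntry n) : ℕ := min R (s.lower - e.cur)

/-- The state at the beginning of day `t + 1`, when expert `x` joins the pool if a new epoch
begins. An epoch has `E` days, and after `N` epochs the level starts afresh. -/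
def step (q R E N t a : ℕ) (l : Fin n → ℕ) (x : Fin n) (s : LevelState n) : LevelState n :=
  if E ∣ t + 1 then
    ⟨0, fresh x :: if E * N ∣ t + 1 then [] else
      closeEpoch q R (entryGain R (s.accumulate a l)) (s.accumulate a l).pool⟩
  else s.accumulate a l

/-- The state at the beginning of day `t`, when the level below has loss `a t` and expert `i`
has loss `l t i` on day `t`, and expert `X t` joins on day `t` if an epoch begins on this day. -/
def run (q R E N : ℕ) (a : ℕ → ℕ) (l : ℕ → Fin n → ℕ) (X : ℕ → Fin n) : ℕ → LevelState n
  | 0 => ⟨0, [fresh (X 0)]⟩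
  | t + 1 => step q R E N t (a t) (l t) (X (t + 1)) (run q R E N a l X t)

section Run

variable (q R E N : ℕ) (a : ℕ → ℕ) (l : ℕ → Fin n → ℕ) (X : ℕ → Fin n)

/-- The gains of the experts in epoch `s` of the instance that starts on day `d`. -/
def epochGain (d s : ℕ) (i : Fin n) : ℕ :=
  min R (∑ k ∈ range E, a (d + s * E + k) - ∑ k ∈ range E, l (d + s * E + k) i)

/-- The pool in epoch `s` of the instance that starts on day `d`. -/
abbrev instancePool (d s : ℕ) : List (PoolEntry n) :=
  Pool.pool q R (epochGain R E a l d) (fun s => X (d + s * E)) s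

theorem cur_eq_zero_of_mem_pool {G : ℕ → Fin n → ℕ} {s : ℕ} {e : PoolEntry n}
    (he : e ∈ Pool.pool q R G X s) : e.cur = 0 := by
  rcases List.mem_cons.1 he with rfl | he
  · rfl
  · cases s with
    | zero => simp [older] at he
    | succ s =>
      obtain ⟨-, e₀, -, b, -, rfl⟩ := mem_closeEpoch he
      rfl

theorem run_add {d : ℕ} (hd : E ∣ d) {p : List (PoolEntry n)}
    (h : run q R E N a l X d = ⟨0, p⟩) {r : ℕ} (hr : r < E) :
    run q R E N a l X (d + r) = during a l d p r := by
  induction r with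
  | zero => rw [during_zero, add_zero, h]
  | succ r ih =>
    have hndvd : ¬ E ∣ d + r + 1 := by
      rw [add_assoc, Nat.dvd_add_right hd]
      exact Nat.not_dvd_of_pos_of_lt (by omega) hr
    rw [← add_assoc, run, step, if_neg hndvd, ih (by omega), accumulate_during]

theorem run_add_epoch (hE : 0 < E) {d s : ℕ} (hd : E ∣ d) {p : List (PoolEntry n)}
    (hp : ∀ e ∈ p, e.cur = 0) (h : run q R E N a l X (d + s * E) = ⟨0, p⟩) :
    run q R E N a l X (d + (s + 1) * E) = ⟨0, fresh (X (d + (s + 1) * E)) ::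
      if E * N ∣ d + (s + 1) * E then [] else
        closeEpoch q R (fun e => epochGain R E a l d s e.expert) p⟩ := by
  obtain ⟨r, rfl⟩ := Nat.exists_eq_add_one.2 hE
  have hlast := run_add q R (r + 1) N a l X (dvd_add hd (dvd_mul_left _ s)) h (Nat.lt_add_one r)
  have hday : d + (s + 1) * (r + 1) = d + s * (r + 1) + r + 1 := by ring
  have hdvd : (r + 1) ∣ d + s * (r + 1) + r + 1 := hday ▸ dvd_add hd (dvd_mul_left _ (s + 1))
  rw [hday, run, step, if_pos hdvd, hlast, accumulate_during]
  congr 3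
  simp only [during]
  rw [closeEpoch_map q R _ (f := addLoss _) (fun _ _ _ => rfl)]
  refine closeEpoch_congr _ _ fun e he => ?_
  simp [entryGain, epochGain, addLoss, hp e he]

theorem run_epoch_of_run_start (hE : 0 < E) {d : ℕ} (hd : E * N ∣ d)
    (hstart : run q R E N a l X d = ⟨0, [fresh (X d)]⟩) {s : ℕ} (hs : s < N) :
    run q R E N a l X (d + s * E) = ⟨0, instancePool q R E a l X d s⟩ := by
  induction s with
  | zero => simpa [Pool.pool, older] using hstart
  | succ s ih =>
    have hndvd : ¬ E * N ∣ d + (s + 1) * E := by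
      rw [Nat.dvd_add_right hd, mul_comm _ E, Nat.mul_dvd_mul_iff_left hE]
      exact Nat.not_dvd_of_pos_of_lt s.succ_pos hs
    rw [run_add_epoch q R E N a l X hE (dvd_of_mul_right_dvd hd)
      (fun e he => cur_eq_zero_of_mem_pool q R _ he) (ih (by omega)), if_neg hndvd]
    rfl

theorem run_start (hE : 0 < E) (hN : 0 < N) {d : ℕ} (hd : E * N ∣ d) :
    run q R E N a l X d = ⟨0, [fresh (X d)]⟩ := by
  obtain ⟨I, rfl⟩ := hd
  induction I with
  | zero => rfl
  | succ I ih =>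
    obtain ⟨m, rfl⟩ := Nat.exists_eq_add_one.2 hN
    have hlast := run_add_epoch q R E (m + 1) a l X hE ⟨(m + 1) * I, mul_assoc _ _ _⟩
      (fun e he => cur_eq_zero_of_mem_pool q R _ he)
      (run_epoch_of_run_start q R E (m + 1) a l X hE (dvd_mul_right _ I) ih (Nat.lt_add_one m))
    have hday : E * (m + 1) * I + (m + 1) * E = E * (m + 1) * (I + 1) := by ring
    rwa [hday, if_pos (dvd_mul_right _ _)] at hlast

theorem run_epoch (hE : 0 < E) {d : ℕ} (hd : E * N ∣ d) {s : ℕ} (hs : s < N) :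
    run q R E N a l X (d + s * E) = ⟨0, instancePool q R E a l X d s⟩ :=
  run_epoch_of_run_start q R E N a l X hE hd (run_start q R E N a l X hE (by omega) hd) hs

theorem run_day (hE : 0 < E) {d : ℕ} (hd : E * N ∣ d) {s r : ℕ} (hs : s < N) (hr : r < E) :
    run q R E N a l X (d + s * E + r) =
      during a l (d + s * E) (instancePool q R E a l X d s) r :=
  run_add q R E N a l X (dvd_add (dvd_of_mul_right_dvd hd) (dvd_mul_left E s))
    (run_epoch q R E N a l X hE hd hs) hr

theorem length_instancePool_le (hR : 0 < R) (d : ℕ) {s : ℕ} (hs : s ≤ N) :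
    ((instancePool q R E a l X d s).length : ℝ) ≤ q * (1 + Real.log N) + 1 := by
  rw [instancePool, Pool.pool, List.length_cons]
  push_cast
  gcongr
  exact length_older_le q R _ hR (fun _ _ => min_le_left _ _) hs

variable {q R E N a l} {η : ℝ} {Q : ℕ}

theorem sum_loss_epoch_le (hη : 0 < η) (hηQ : η * Q ≤ 1) (hE : 0 < E) (hR : 0 < R)
    (ha : ∀ t, a t ≤ Q) (hl : ∀ t i, l t i ≤ Q) {d : ℕ} (hd : E * N ∣ d) {s : ℕ} (hs : s < N) :
    (∑ k ∈ range E, ((run q R E N a l X (d + s * E + k)).loss η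
        (a (d + s * E + k)) (l (d + s * E + k)) : ℝ)) ≤
      ∑ k ∈ range E, (a (d + s * E + k) : ℝ) -
        bestGain (epochGain R E a l d s) (instancePool q R E a l X d s) +
        hedgeRegret η Q E (q * (1 + Real.log N) + 2) := by
  set p := instancePool q R E a l X d s
  have hcur (e) (he : e ∈ p) : e.cur = 0 := cur_eq_zero_of_mem_pool q R _ he
  have hregret (c : ℕ) (hc : weight η c ≤ (during a l (d + s * E) p E).norm η) :
      (∑ k ∈ range E, ((run q R E N a l X (d + s * E + k)).loss η
        (a (d + s * E + k)) (l (d + s * E + k)) : ℝ)) ≤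
      c + hedgeRegret η Q E (q * (1 + Real.log N) + 2) := by
    have hlen : (p.length : ℝ) + 1 ≤ q * (1 + Real.log N) + 2 := by
      linarith [length_instancePool_le q R E N a l X hR d hs.le]
    rw [sum_congr rfl fun k hk => by rw [run_day q R E N a l X hE hd hs (mem_range.1 hk)]]
    refine (sum_loss_during_le hη hηQ ha hl hcur hc).trans ?_
    unfold hedgeRegret
    gcongr
  have hlower := hregret _ (weight_lower_le_norm η _)
  simp only [during, Nat.cast_sum] at hlower
  suffices hgain : (bestGain (epochGain R E a l d s) p : ℝ) ≤
      ∑ k ∈ range E, (a (d + s * E + k) : ℝ) + hedgeRegret η Q E (q * (1 + Real.log N) + 2) -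
        ∑ k ∈ range E, ((run q R E N a l X (d + s * E + k)).loss η
          (a (d + s * E + k)) (l (d + s * E + k)) : ℝ) by linarith
  refine cast_topGain_le (by linarith) fun e he => ?_
  have hexpert := hregret _ (weight_cur_le_norm η _ (List.mem_map_of_mem he))
  simp only [addLoss, hcur e he, zero_add, Nat.cast_sum] at hexpert
  rcases le_total (∑ k ∈ range E, a (d + s * E + k))
    (∑ k ∈ range E, l (d + s * E + k) e.expert) with h | h
  · simp only [epochGain, Nat.sub_eq_zero_of_le h, Nat.min_zero, Nat.cast_zero]
    linarith
  · have hmin : (epochGain R E a l d s e.expert : ℝ) ≤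
        (∑ k ∈ range E, a (d + s * E + k) - ∑ k ∈ range E, l (d + s * E + k) e.expert : ℕ) := by
      exact_mod_cast min_le_right _ _
    push_cast [Nat.cast_sub h] at hmin
    linarith

theorem sum_range_mul_eq {β : Type*} [AddCommMonoid β] (f : ℕ → β) (d E M : ℕ) :
    ∑ k ∈ range (E * M), f (d + k) = ∑ s ∈ range M, ∑ k ∈ range E, f (d + s * E + k) := by
  induction M with
  | zero => simp
  | succ M ih =>
    rw [mul_add, mul_one, sum_range_add, sum_range_succ, ih]
    simp only [mul_comm M E, add_assoc]

/-- The gain of expert `i` over the level below is split into the gain of the pool, which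
exponential weights collect, and the loss in the eviction rule and the failed trials. -/
theorem sum_loss_run_le (hη : 0 < η) (hηQ : η * Q ≤ 1) (hE : 0 < E) (hq : 0 < q) (hR : 0 < R)
    (ha : ∀ t, a t ≤ Q) (hl : ∀ t i, l t i ≤ Q) {d : ℕ} (hd : E * N ∣ d) (i : Fin n) {M : ℕ}
    (hM : M ≤ N) (hlow : ∀ s < M, ∑ k ∈ range E, a (d + s * E + k) ≤
      ∑ k ∈ range E, l (d + s * E + k) i + R) :
    (∑ k ∈ range (E * M), ((run q R E N a l X (d + k)).loss η (a (d + k)) (l (d + k)) : ℝ)) ≤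
      ∑ k ∈ range (E * M), (l (d + k) i : ℝ) + R * M / q +
      R * failures q R (epochGain R E a l d) (fun s => X (d + s * E)) i M +
      M * hedgeRegret η Q E (q * (1 + Real.log N) + 2) := by
  set G := epochGain R E a l d
  set X' : ℕ → Fin n := fun s => X (d + s * E)
  have hepoch : ∀ s ∈ range M, ∑ k ∈ range E, ((run q R E N a l X (d + s * E + k)).loss η
        (a (d + s * E + k)) (l (d + s * E + k)) : ℝ) ≤
      ∑ k ∈ range E, (l (d + s * E + k) i : ℝ) + G s i - bestGain (G s) (Pool.pool q R G X' s) +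
        hedgeRegret η Q E (q * (1 + Real.log N) + 2) := fun s hs => by
    have hs := mem_range.1 hs
    have hG : (∑ k ∈ range E, a (d + s * E + k) : ℝ) ≤
        ∑ k ∈ range E, (l (d + s * E + k) i : ℝ) + G s i := by
      have := hlow s hs
      simp only [G, epochGain]
      exact_mod_cast (by omega)
    have hregret := sum_loss_epoch_le (q := q) X hη hηQ hE hR ha hl hd (hs.trans_le hM)
    linarith
  have hgain : (∑ τ ∈ range M, (G τ i : ℝ)) ≤
      ∑ τ ∈ range M, (bestGain (G τ) (Pool.pool q R G X' τ) : ℝ) + R * M / q +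
        R * failures q R G X' i M := by
    have hq' : (0 : ℝ) < q := by exact_mod_cast hq
    have h : (q : ℝ) * (∑ τ ∈ range M, (G τ i : ℝ)) ≤
        q * ∑ τ ∈ range M, (bestGain (G τ) (Pool.pool q R G X' τ) : ℝ) + R * M +
          q * R * failures q R G X' i M := by
      exact_mod_cast sum_gain_le q R G X' (fun _ => min_le_left _ _) M
    refine le_of_mul_le_mul_left (h.trans_eq ?_) hq'
    field_simp
  rw [sum_range_mul_eq (fun t => ((run q R E N a l X t).loss η (a t) (l t) : ℝ)),
    sum_range_mul_eq (fun t => (l t i : ℝ))]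
  refine (sum_le_sum hepoch).trans ?_
  rw [sum_add_distrib, sum_sub_distrib, sum_add_distrib, sum_const, card_range, nsmul_eq_mul]
  linarith

end Run

end LevelState

theorem log_le_of_lt_two_pow {x m : ℕ} (h : x < 2 ^ m) : Real.log x ≤ m := by
  rcases x.eq_zero_or_pos with rfl | hx
  · simp
  · calc Real.log x ≤ Real.log (2 ^ m) :=
          Real.log_le_log (by exact_mod_cast hx) (by exact_mod_cast h.le)
      _ = m * Real.log 2 := Real.log_pow 2 m
      _ ≤ m := mul_le_of_le_one_right m.cast_nonneg (by linarith [Real.log_two_lt_d9])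

/-- The number of experts and days, and the inverse `q` of the slack in the eviction rule. -/
structure Params where
  n : ℕ
  T : ℕ
  q : ℕ
  n_pos : 0 < n
  T_pos : 0 < T
  q_pos : 0 < q
  q_le : q ≤ n

namespace Params

open LevelState Pool

variable (P : Params)

instance : NeZero P.n := ⟨P.n_pos.ne'⟩

/-- The number of bits in a word. -/
def wordBits : ℕ := Nat.log 2 (P.n * P.T) + 1

/-- The number of epochs in an instance of a level. -/
def epochs : ℕ := P.n * P.q

/-- The number of levels. -/
def levels : ℕ := Nat.log P.epochs P.T

/-- The number of days in an epoch of level `j`. An epoch of level `j + 1` is an instance of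
level `j`. -/
def epochLen (j : ℕ) : ℕ := P.epochs ^ (j + 1)

/-- The bound for the regret in an epoch of level `j`; losses are measured in units of `1 / T`. -/
def regretBound (j : ℕ) : ℕ := P.epochs * P.T * (P.n * (10 * P.wordBits ^ 2)) ^ j

/-- The learning rate of level `j`. -/
noncomputable def rate (j : ℕ) : ℝ := 1 / (P.T * P.n ^ (j + 1))

/-- The number of failed trials that is tolerated in an instance. -/
def maxFailures : ℕ := 2 * P.n * P.wordBits ^ 2

/-- The loss on day `t` of the algorithm with the lowest `j` levels, when `X j t` is the expert
drawn by level `j` on day `t`. Without any level, it follows expert `0`. -/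
noncomputable def levelLoss (l : ℕ → Fin P.n → ℕ) (X : ℕ → ℕ → Fin P.n) : ℕ → ℕ → ℕ
  | 0, t => l t 0
  | j + 1, t => (run P.q (P.regretBound j) (P.epochLen j) P.epochs (levelLoss l X j) l (X j) t).loss
      (P.rate j) (levelLoss l X j t) (l t)

/-- The state of level `j` at the beginning of day `t`. -/
noncomputable def levelState (l : ℕ → Fin P.n → ℕ) (X : ℕ → ℕ → Fin P.n) (j : ℕ) :
    ℕ → LevelState P.n :=
  run P.q (P.regretBound j) (P.epochLen j) P.epochs (P.levelLoss l X j) l (X j)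

/-- The first day of instance `I` of level `j`. -/
def start (j I : ℕ) : ℕ := I * P.epochLen (j + 1)

/-- The number of epochs of instance `I` of level `j` that begin before day `T`. -/
def activeEpochs (j I : ℕ) : ℕ := min P.epochs ((P.T - P.start j I) ⌈/⌉ P.epochLen j)

/-- The gains of the experts over level `j` in the epochs of instance `I`. -/
noncomputable def instanceGain (l : ℕ → Fin P.n → ℕ) (X : ℕ → ℕ → Fin P.n) (j I : ℕ) :
    ℕ → Fin P.n → ℕ :=
  epochGain (P.regretBound j) (P.epochLen j) (P.levelLoss l X j) l (P.start j I)

/-- The number of failed trials for expert `i` in instance `I` of level `j`. -/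
noncomputable def instanceFailures (l : ℕ → Fin P.n → ℕ) (X : ℕ → ℕ → Fin P.n) (i : Fin P.n)
    (j I : ℕ) : ℕ :=
  failures P.q (P.regretBound j) (P.instanceGain l X j I)
    (fun s => X j (P.start j I + s * P.epochLen j)) i (P.activeEpochs j I)

theorem wordBits_pos : 0 < P.wordBits := Nat.succ_pos _

theorem epochs_pos : 0 < P.epochs := Nat.mul_pos P.n_pos P.q_pos

theorem epochLen_pos (j : ℕ) : 0 < P.epochLen j := pow_pos P.epochs_pos _

theorem epochLen_succ (j : ℕ) : P.epochLen (j + 1) = P.epochLen j * P.epochs := pow_succ _ _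

theorem regretBound_pos (j : ℕ) : 0 < P.regretBound j := by
  have := P.epochs_pos
  have := P.T_pos
  have := P.n_pos
  have := P.wordBits_pos
  unfold regretBound
  positivity

theorem regretBound_succ (j : ℕ) :
    P.regretBound (j + 1) = 10 * P.wordBits ^ 2 * (P.regretBound j * P.n) := by
  simp only [regretBound]
  ring

theorem rate_pos (j : ℕ) : 0 < P.rate j := by
  have := P.T_pos
  have := P.n_pos
  unfold rate
  positivity

theorem one_le_n_pow (j : ℕ) : (1 : ℝ) ≤ P.n ^ j :=
  one_le_pow₀ (by exact_mod_cast P.n_pos)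

theorem rate_mul_T_le_one (j : ℕ) : P.rate j * P.T ≤ 1 := by
  have hT : (0 : ℝ) < P.T := by exact_mod_cast P.T_pos
  have hn := P.one_le_n_pow (j + 1)
  rw [rate, div_mul_eq_mul_div, one_mul, div_le_one (by positivity)]
  exact le_mul_of_one_le_right hT.le hn

theorem epochs_le : P.epochs ≤ P.n ^ 2 := by
  rw [epochs, sq]
  exact Nat.mul_le_mul_left _ P.q_le

theorem mul_lt_two_pow_wordBits : P.n * P.T < 2 ^ P.wordBits :=
  Nat.lt_pow_succ_log_self (by norm_num) _

theorem n_lt_two_pow_wordBits : P.n < 2 ^ P.wordBits :=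
  (Nat.le_mul_of_pos_right _ P.T_pos).trans_lt P.mul_lt_two_pow_wordBits

theorem T_lt_two_pow_wordBits : P.T < 2 ^ P.wordBits :=
  (Nat.le_mul_of_pos_left _ P.n_pos).trans_lt P.mul_lt_two_pow_wordBits

theorem log_epochs_le : Real.log P.epochs ≤ 2 * P.wordBits := by
  have h : P.epochs < 2 ^ (2 * P.wordBits) := by
    refine P.epochs_le.trans_lt ?_
    rw [mul_comm, pow_mul]
    exact Nat.pow_lt_pow_left P.n_lt_two_pow_wordBits two_ne_zero
  exact_mod_cast log_le_of_lt_two_pow h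

theorem epochLen_le_T {j : ℕ} (hj : j < P.levels) : P.epochLen j ≤ P.T :=
  (Nat.pow_le_pow_right P.epochs_pos hj).trans (Nat.pow_log_le_self _ P.T_pos.ne')

theorem T_le_epochLen_levels (hn : 1 < P.n) : P.T ≤ P.epochLen P.levels :=
  (Nat.lt_pow_succ_log_self (hn.trans_le (Nat.le_mul_of_pos_right _ P.q_pos)) P.T).le

theorem levelLoss_le {l : ℕ → Fin P.n → ℕ} {Q : ℕ} (hl : ∀ t i, l t i ≤ Q)
    (X : ℕ → ℕ → Fin P.n) (j t : ℕ) : P.levelLoss l X j t ≤ Q := by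
  induction j generalizing t with
  | zero => exact hl _ _
  | succ j ih => exact loss_le _ _ (ih t) (hl t)

theorem levelLoss_eq_zero {l : ℕ → Fin P.n → ℕ} {t : ℕ} (hl : ∀ i, l t i = 0)
    (X : ℕ → ℕ → Fin P.n) (j : ℕ) : P.levelLoss l X j t = 0 := by
  induction j with
  | zero => exact hl _
  | succ j ih =>
    rw [levelLoss, ih]
    exact Nat.le_zero.1 (loss_le _ _ le_rfl fun i => (hl i).le)

theorem levelLoss_congr (l : ℕ → Fin P.n → ℕ) {X X' : ℕ → ℕ → Fin P.n} {j : ℕ}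
    (h : ∀ r < j, X r = X' r) : P.levelLoss l X j = P.levelLoss l X' j := by
  induction j with
  | zero => rfl
  | succ j ih =>
    funext t
    rw [levelLoss, levelLoss, ih fun r hr => h r (by omega), h j (by omega)]

theorem log_options_le :
    Real.log (P.q * (1 + Real.log P.epochs) + 2) ≤ 3 * P.wordBits + 2 := by
  have hn : (1 : ℝ) ≤ P.n := by exact_mod_cast P.n_pos
  have hq : (P.q : ℝ) ≤ P.n := by exact_mod_cast P.q_le
  have : 0 ≤ Real.log P.epochs := Real.log_natCast_nonneg _
  have hoptions : (P.q : ℝ) * (1 + Real.log P.epochs) + 2 ≤ P.n * (2 * P.wordBits + 3) := by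
    calc (P.q : ℝ) * (1 + Real.log P.epochs) + 2
        ≤ P.n * (1 + 2 * P.wordBits) + P.n * 2 := by
          gcongr
          · exact P.log_epochs_le
          · linarith
      _ = _ := by ring
  calc _ ≤ Real.log (P.n * (2 * P.wordBits + 3)) := Real.log_le_log (by positivity) hoptions
    _ = Real.log P.n + Real.log (2 * P.wordBits + 3) :=
        Real.log_mul (by positivity) (by positivity)
    _ ≤ P.wordBits + (2 * P.wordBits + 3 - 1) :=
        add_le_add (log_le_of_lt_two_pow P.n_lt_two_pow_wordBits)
          (Real.log_le_sub_one_of_pos (by positivity))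
    _ = _ := by ring

theorem epochLen_mul_rate_le {j : ℕ} (hj : j < P.levels) :
    P.epochLen j * (P.rate j * P.T ^ 2 + 1) ≤ 2 * (P.T * P.n ^ (j + 1)) := by
  have hn := P.one_le_n_pow (j + 1)
  have : (0 : ℝ) < P.n ^ (j + 1) := by linarith
  have hT : (0 : ℝ) < P.T := by exact_mod_cast P.T_pos
  have hlen : (P.epochLen j : ℝ) ≤ P.n ^ (j + 1) * P.n ^ (j + 1) := by
    rw [← mul_pow, ← sq]
    exact_mod_cast Nat.pow_le_pow_left P.epochs_le (j + 1)
  have hlenT : (P.epochLen j : ℝ) ≤ P.T := by exact_mod_cast P.epochLen_le_T hj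
  calc P.epochLen j * (P.rate j * P.T ^ 2 + 1)
      = P.epochLen j * P.T / P.n ^ (j + 1) + P.epochLen j := by
        rw [rate]
        field_simp
    _ ≤ P.n ^ (j + 1) * P.n ^ (j + 1) * P.T / P.n ^ (j + 1) + P.T * P.n ^ (j + 1) := by
        gcongr
        exact hlenT.trans (le_mul_of_one_le_right hT.le hn)
    _ = _ := by
        field_simp
        ring

theorem hedgeRegret_le {j : ℕ} (hj : j < P.levels) :
    hedgeRegret (P.rate j) P.T (P.epochLen j) (P.q * (1 + Real.log P.epochs) + 2) ≤
      (3 * P.wordBits + 4) * (P.T * P.n ^ (j + 1)) := by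
  have hlog : Real.log (P.q * (1 + Real.log P.epochs) + 2) / P.rate j ≤
      (3 * P.wordBits + 2) * (P.T * P.n ^ (j + 1)) := by
    rw [rate, div_div_eq_mul_div, div_one]
    gcongr
    exact P.log_options_le
  have hlen := P.epochLen_mul_rate_le hj
  rw [hedgeRegret]
  linarith

theorem epochs_mul_le_regretBound (j : ℕ) :
    P.epochs * (P.T * P.n ^ (j + 1)) ≤ P.regretBound j * P.n := by
  have hL : 0 < P.wordBits ^ 2 := pow_pos P.wordBits_pos 2
  calc P.epochs * (P.T * P.n ^ (j + 1)) = P.epochs * P.T * P.n ^ j * P.n := by ring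
    _ ≤ _ := by
        unfold regretBound
        gcongr
        exact Nat.le_mul_of_pos_right _ (by omega)

/-- The error terms of an instance are at most the regret bound for the epochs of the level
above. -/
theorem instance_error_le {j M : ℕ} (hj : j < P.levels) (hM : M ≤ P.epochs) :
    (P.regretBound j : ℝ) * M / P.q + P.regretBound j * P.maxFailures +
      M * hedgeRegret (P.rate j) P.T (P.epochLen j) (P.q * (1 + Real.log P.epochs) + 2) ≤
      P.regretBound (j + 1) := by
  have hq : (0 : ℝ) < P.q := by exact_mod_cast P.q_pos
  have hL : (1 : ℝ) ≤ P.wordBits := by exact_mod_cast P.wordBits_pos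
  have hMq : (M : ℝ) / P.q ≤ P.n := by
    rw [div_le_iff₀ hq]
    exact_mod_cast hM
  have hMn : (M : ℝ) * (P.T * P.n ^ (j + 1)) ≤ P.regretBound j * P.n := by
    calc (M : ℝ) * (P.T * P.n ^ (j + 1)) ≤ P.epochs * (P.T * P.n ^ (j + 1)) := by gcongr
      _ ≤ _ := by exact_mod_cast P.epochs_mul_le_regretBound j
  calc _ ≤ (P.regretBound j : ℝ) * P.n + P.regretBound j * P.maxFailures +
        M * ((3 * P.wordBits + 4) * (P.T * P.n ^ (j + 1))) := by
        rw [mul_div_assoc]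
        gcongr
        exact P.hedgeRegret_le hj
    _ = (1 + 2 * P.wordBits ^ 2) * (P.regretBound j * P.n) +
          (3 * P.wordBits + 4) * (M * (P.T * P.n ^ (j + 1))) := by
        rw [maxFailures]
        push_cast
        ring
    _ ≤ (1 + 2 * P.wordBits ^ 2) * (P.regretBound j * P.n) +
          (3 * P.wordBits + 4) * (P.regretBound j * P.n) := by gcongr
    _ = (2 * P.wordBits ^ 2 + 3 * P.wordBits + 5) * (P.regretBound j * P.n) := by ring
    _ ≤ 10 * P.wordBits ^ 2 * (P.regretBound j * P.n) := by
        gcongr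
        nlinarith
    _ = _ := by
        rw [regretBound_succ]
        push_cast
        ring

theorem start_add_lt_T {j I s : ℕ} (hs : s < P.activeEpochs j I) :
    P.start j I + s * P.epochLen j < P.T := by
  have hceil : s < (P.T - P.start j I) ⌈/⌉ P.epochLen j := hs.trans_le (min_le_right _ _)
  rw [← not_le, ceilDiv_le_iff_le_mul (P.epochLen_pos j)] at hceil
  rw [mul_comm] at hceil
  omega

theorem sum_instance_eq {f : ℕ → ℕ} (hf : ∀ t, P.T ≤ t → f t = 0) (j I : ℕ) :
    ∑ k ∈ range (P.epochLen (j + 1)), f (P.start j I + k) =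
      ∑ k ∈ range (P.epochLen j * P.activeEpochs j I), f (P.start j I + k) := by
  refine (sum_subset (range_subset_range.2 ?_) fun k hk hk' => hf _ ?_).symm
  · rw [epochLen_succ]
    exact Nat.mul_le_mul_left _ (min_le_left _ _)
  · rw [mem_range, epochLen_succ] at hk
    rw [mem_range, not_lt, activeEpochs] at hk'
    rcases le_total P.epochs ((P.T - P.start j I) ⌈/⌉ P.epochLen j) with h | h
    · rw [min_eq_left h] at hk'
      omega
    · rw [min_eq_right h] at hk'
      have := (ceilDiv_le_iff_le_mul (P.epochLen_pos j)).1
        (le_refl ((P.T - P.start j I) ⌈/⌉ P.epochLen j))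
      omega

/-- The regret of the lowest `j` levels in every epoch of level `j`, if no instance has too many
failed trials. -/
theorem sum_levelLoss_le {l : ℕ → Fin P.n → ℕ} (hl : ∀ t i, l t i ≤ P.T)
    (hl0 : ∀ t i, P.T ≤ t → l t i = 0) (X : ℕ → ℕ → Fin P.n) (i : Fin P.n)
    (hfail : ∀ j < P.levels, ∀ I, P.instanceFailures l X i j I ≤ P.maxFailures)
    {j : ℕ} (hj : j ≤ P.levels) (I : ℕ) :
    ∑ k ∈ range (P.epochLen j), P.levelLoss l X j (I * P.epochLen j + k) ≤
      ∑ k ∈ range (P.epochLen j), l (I * P.epochLen j + k) i + P.regretBound j := by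
  induction j generalizing I with
  | zero =>
    refine le_trans (sum_le_card_nsmul _ _ P.T fun k _ => P.levelLoss_le hl X 0 _) ?_
    simp [epochLen, regretBound]
  | succ j ih =>
    have hM : P.activeEpochs j I ≤ P.epochs := min_le_left _ _
    have hstart : P.epochLen j * P.epochs ∣ P.start j I := P.epochLen_succ j ▸ dvd_mul_left _ _
    have hlow (s : ℕ) : ∑ k ∈ range (P.epochLen j),
          P.levelLoss l X j (P.start j I + s * P.epochLen j + k) ≤
        ∑ k ∈ range (P.epochLen j), l (P.start j I + s * P.epochLen j + k) i +
          P.regretBound j := by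
      have hday : P.start j I + s * P.epochLen j = (I * P.epochs + s) * P.epochLen j := by
        rw [start, epochLen_succ]
        ring
      rw [hday]
      exact ih (by omega) _
    have hrun := sum_loss_run_le (q := P.q) (X j) (P.rate_pos j) (P.rate_mul_T_le_one j)
      (P.epochLen_pos j) P.q_pos (P.regretBound_pos j) (P.levelLoss_le hl X j) hl hstart i hM
      fun s _ => hlow s
    have hfailures : (P.regretBound j : ℝ) * P.instanceFailures l X i j I ≤
        P.regretBound j * P.maxFailures := by
      exact_mod_cast Nat.mul_le_mul_left _ (hfail j hj I)
    have herror := P.instance_error_le hj hM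
    rw [instanceFailures, instanceGain] at hfailures
    change ∑ k ∈ range (P.epochLen (j + 1)), P.levelLoss l X (j + 1) (P.start j I + k) ≤
      ∑ k ∈ range (P.epochLen (j + 1)), l (P.start j I + k) i + _
    rw [P.sum_instance_eq fun t ht => P.levelLoss_eq_zero (hl0 t · ht) X _,
      P.sum_instance_eq (f := (l · i)) fun t ht => hl0 t i ht]
    rw [← Nat.cast_le (α := ℝ)]
    push_cast
    refine hrun.trans ?_
    linarith

theorem sum_levelLoss_levels_le (hn : 1 < P.n) {l : ℕ → Fin P.n → ℕ}
    (hl : ∀ t i, l t i ≤ P.T) (hl0 : ∀ t i, P.T ≤ t → l t i = 0) (X : ℕ → ℕ → Fin P.n)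
    (i : Fin P.n)
    (hfail : ∀ j < P.levels, ∀ I, P.instanceFailures l X i j I ≤ P.maxFailures) :
    ∑ t ∈ range P.T, P.levelLoss l X P.levels t ≤
      ∑ t ∈ range P.T, l t i + P.regretBound P.levels := by
  have htruncate {f : ℕ → ℕ} (hf : ∀ t, P.T ≤ t → f t = 0) :
      ∑ t ∈ range (P.epochLen P.levels), f t = ∑ t ∈ range P.T, f t :=
    (sum_subset (range_subset_range.2 (P.T_le_epochLen_levels hn)) fun t _ ht =>
      hf t (by simpa using ht)).symm
  have h := P.sum_levelLoss_le hl hl0 X i hfail le_rfl 0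
  simp only [zero_mul, zero_add] at h
  rwa [htruncate fun t ht => P.levelLoss_eq_zero (hl0 t · ht) X _,
    htruncate fun t ht => hl0 t i ht] at h

end Params

section Sampling

/-- A uniformly random element of `U` can be turned into an element of `ι` that takes each value `i`
on at least `c i` elements of `U`. -/
theorem exists_map_le_card_fiber {ι U : Type*} [Fintype ι] [Nonempty ι] [DecidableEq ι] [Fintype U]
    {c : ι → ℕ} (hc : ∑ i, c i ≤ Fintype.card U) :
    ∃ f : U → ι, ∀ i, c i ≤ #{u | f u = i} := by
  obtain ⟨φ⟩ : Nonempty ((Σ i, Fin (c i)) ↪ U) :=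
    Function.Embedding.nonempty_of_card_le (by simpa using hc)
  refine ⟨Function.extend φ Sigma.fst fun _ => Classical.arbitrary ι, fun i => ?_⟩
  calc c i = #(univ : Finset (Fin (c i))) := (card_fin _).symm
    _ ≤ _ := card_le_card_of_injOn (fun x => φ ⟨i, x⟩)
        (fun x _ => by simp [φ.injective.extend_apply])
        (fun x _ y _ h => by simpa using φ.injective h)

/-- Rounding the distribution `p` to multiples of `1 / card U` costs at most `1 / card U` per
outcome. -/
theorem exists_map_sum_le {ι U : Type*} [Fintype ι] [Nonempty ι] [Fintype U] {p : ι → ℝ}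
    (hp : ∀ i, 0 ≤ p i) (hsum : ∑ i, p i = 1) :
    ∃ f : U → ι, ∀ h : ι → ℝ, (∀ i, 0 ≤ h i) → (∀ i, h i ≤ 1) →
      ∑ u, h (f u) ≤ Fintype.card U * ∑ i, p i * h i + Fintype.card ι := by
  classical
  set K : ℝ := (Fintype.card U : ℝ) with hK
  have hpK (i) : 0 ≤ p i * K := mul_nonneg (hp i) (Nat.cast_nonneg _)
  have hfloor : ∑ i, ⌊p i * K⌋₊ ≤ Fintype.card U := by
    rw [← Nat.cast_le (α := ℝ), Nat.cast_sum]
    calc ∑ i, (⌊p i * K⌋₊ : ℝ) ≤ ∑ i, p i * K := sum_le_sum fun i _ => Nat.floor_le (hpK i)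
      _ = K := by rw [← sum_mul, hsum, one_mul]
  obtain ⟨f, hf⟩ := exists_map_le_card_fiber hfloor
  refine ⟨f, fun h h0 h1 => ?_⟩
  have hcard : ∑ i, (#{u | f u = i} : ℝ) = K := by
    rw [hK, ← card_univ, card_eq_sum_card_fiberwise (f := f) (t := univ) (by simp), Nat.cast_sum]
  calc ∑ u, h (f u) = ∑ i, (#{u | f u = i} : ℝ) * h i := by
        simp only [← sum_fiberwise' univ f h, sum_const, nsmul_eq_mul]
    _ ≤ ∑ i, (K * (p i * h i) + (#{u | f u = i} - p i * K + 1)) := by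
        refine sum_le_sum fun i _ => ?_
        have hfiber : (⌊p i * K⌋₊ : ℝ) ≤ #{u | f u = i} := by exact_mod_cast hf i
        have hexcess : 0 ≤ #{u | f u = i} - p i * K + 1 := by
          linarith [Nat.lt_floor_add_one (p i * K)]
        linarith [mul_le_mul_of_nonneg_left (h1 i) hexcess, h0 i]
    _ = _ := by
        rw [sum_add_distrib, sum_add_distrib, sum_sub_distrib, hcard, ← sum_mul, hsum, ← mul_sum]
        simp

end Sampling

namespace Params

open LevelState Pool

variable (P : Params)

/-- A block of random bits. -/
abbrev Block : Type := Fin P.wordBits → Bool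

/-- The names of the blocks of random bits: block `(d, 0)` serves for the choice of an expert on
day `d - 1`, block `(d, j + 1)` for the expert that joins the pool of level `j` on day `d`. -/
abbrev BlockIndex : Type := Fin (P.T + 1) × Fin (P.levels + 1)

/-- The random bits of a run. -/
abbrev Blocks : Type := P.BlockIndex → P.Block

/-- The block that serves for the choice of an expert on day `t`. -/
def playBlock (t : ℕ) : P.BlockIndex := (⟨min (t + 1) P.T, by omega⟩, 0)

/-- The block that serves for the expert that joins the pool of level `j` on day `d`. -/
def drawBlock {j : ℕ} (hj : j < P.levels) (d : ℕ) : P.BlockIndex :=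
  (⟨min d P.T, by omega⟩, ⟨j + 1, by omega⟩)

theorem mul_le_card_block : P.n * P.T ≤ Fintype.card P.Block := by
  simpa using P.mul_lt_two_pow_wordBits.le

theorem exists_draw : ∃ f : P.Block → Fin P.n,
    ∀ i, Fintype.card P.Block / P.n ≤ #{u | f u = i} := by
  apply exists_map_le_card_fiber
  simpa using Nat.mul_div_le (Fintype.card P.Block) P.n

/-- A nearly uniformly random expert. -/
noncomputable def draw : P.Block → Fin P.n := P.exists_draw.choose

theorem le_card_draw (i : Fin P.n) :
    1 / (2 * P.n : ℝ) * Fintype.card P.Block ≤ #{u | P.draw u = i} := by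
  have hn : (0 : ℝ) < P.n := by exact_mod_cast P.n_pos
  have hle : P.n ≤ Fintype.card P.Block :=
    (Nat.le_mul_of_pos_right _ P.T_pos).trans P.mul_le_card_block
  have hquot : Fintype.card P.Block ≤ 2 * P.n * (Fintype.card P.Block / P.n) := by
    nlinarith [Nat.lt_div_mul_add P.n_pos (a := Fintype.card P.Block), Nat.div_pos hle P.n_pos]
  rw [div_mul_eq_mul_div, one_mul, div_le_iff₀ (by positivity), mul_comm]
  exact_mod_cast hquot.trans (Nat.mul_le_mul_left _ (P.exists_draw.choose_spec i))

/-- The expert drawn by level `j` on day `d`. -/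
noncomputable def drawn (ψ : P.Blocks) (j d : ℕ) : Fin P.n :=
  if hj : j < P.levels then P.draw (ψ (P.drawBlock hj d)) else 0

variable {P}

theorem drawn_congr {ψ ψ' : P.Blocks} {j d : ℕ}
    (h : ∀ hj : j < P.levels, ψ (P.drawBlock hj d) = ψ' (P.drawBlock hj d)) :
    P.drawn ψ j d = P.drawn ψ' j d := by
  unfold drawn
  split_ifs with hj
  · rw [h hj]
  · rfl

variable (P)

theorem dependsOn_drawn (t : ℕ) : DependsOn P.drawn {P.playBlock t}ᶜ := fun ψ ψ' h => by
  funext j d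
  exact drawn_congr fun hj => h _ (by simp [drawBlock, playBlock])

theorem drawBlock_injOn {j : ℕ} (hj : j < P.levels) (I : ℕ) :
    Set.InjOn (fun s => P.drawBlock hj (P.start j I + s * P.epochLen j))
      (Set.Iio (P.activeEpochs j I)) := by
  intro r hr s hs h
  have hr := P.start_add_lt_T hr
  have hs := P.start_add_lt_T hs
  have hday := congrArg (fun c : P.BlockIndex => c.1.val) h
  simp only [drawBlock, min_eq_left hr.le, min_eq_left hs.le] at hday
  exact Nat.eq_of_mul_eq_mul_right (P.epochLen_pos j) (by omega)

theorem dependsOn_trial (l : ℕ → Fin P.n → ℕ) (i : Fin P.n) {j : ℕ} (hj : j < P.levels)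
    {I s r : ℕ} (hsr : s ≤ r) (hr : r < P.activeEpochs j I) :
    DependsOn (fun ψ : P.Blocks => Trial P.q (P.regretBound j) (P.instanceGain l (P.drawn ψ) j I)
      (fun s => P.drawn ψ j (P.start j I + s * P.epochLen j)) i (P.activeEpochs j I) s)
      {P.drawBlock hj (P.start j I + r * P.epochLen j)}ᶜ := by
  intro ψ ψ' h
  have hgain : P.instanceGain l (P.drawn ψ) j I = P.instanceGain l (P.drawn ψ') j I := by
    rw [instanceGain, instanceGain, P.levelLoss_congr l fun j' hj' => funext fun d =>
      drawn_congr fun hj'' => h _ ?_]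
    simp [drawBlock, hj'.ne]
  beta_reduce
  rw [hgain]
  refine trial_congr _ _ _ _ (fun s' hs' => drawn_congr fun hj' => h _ fun heq => ?_) i _
  have := P.drawBlock_injOn hj I (Set.mem_Iio.2 (by omega)) (Set.mem_Iio.2 hr) heq
  omega

open scoped Classical in
theorem card_le_instanceFailures_le (l : ℕ → Fin P.n → ℕ) (i : Fin P.n) {j : ℕ}
    (hj : j < P.levels) (I M : ℕ) :
    (#{ψ : P.Blocks | M ≤ P.instanceFailures l (P.drawn ψ) i j I} : ℝ) ≤
      (1 - 1 / (2 * P.n : ℝ)) ^ M * Fintype.card P.Blocks := by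
  have hn : (1 : ℝ) ≤ P.n := by exact_mod_cast P.n_pos
  have hp : 1 / (2 * P.n : ℝ) ≤ 1 := by
    rw [div_le_one (by positivity)]
    linarith
  have hfailed (ψ : P.Blocks) : P.instanceFailures l (P.drawn ψ) i j I = failedTrials
      (Trial P.q (P.regretBound j) (P.instanceGain l (P.drawn ψ) j I)
        (fun s => P.drawn ψ j (P.start j I + s * P.epochLen j)) i (P.activeEpochs j I))
      (fun s => P.draw (ψ (P.drawBlock hj (P.start j I + s * P.epochLen j))) = i)
      (P.activeEpochs j I) :=
    failedTrials_congr (fun _ _ => Iff.rfl) fun _ _ => by simp only [drawn, dif_pos hj]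
  simp only [hfailed]
  exact card_le_failedTrials_le hp (good := fun u => P.draw u = i)
    (by convert P.le_card_draw i) (P.drawBlock_injOn hj I)
    (fun s r hsr hr => P.dependsOn_trial l i hj hsr hr) M

theorem instanceFailures_eq_zero (l : ℕ → Fin P.n → ℕ) (X : ℕ → ℕ → Fin P.n) (i : Fin P.n)
    {j I : ℕ} (hI : P.T ≤ I) : P.instanceFailures l X i j I = 0 := by
  have hstart : P.T ≤ P.start j I :=
    hI.trans (Nat.le_mul_of_pos_right I (P.epochLen_pos (j + 1)))
  have hactive : P.activeEpochs j I = 0 := by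
    simp [activeEpochs, Nat.sub_eq_zero_of_le hstart, zero_ceilDiv]
  simp [instanceFailures, hactive, failures, failedTrials]

theorem one_sub_pow_maxFailures_le :
    (1 - 1 / (2 * P.n : ℝ)) ^ P.maxFailures ≤ Real.exp (-(P.wordBits : ℝ) ^ 2) := by
  have hn : (1 : ℝ) ≤ P.n := by exact_mod_cast P.n_pos
  have hnonneg : 0 ≤ 1 - 1 / (2 * P.n : ℝ) := by
    rw [sub_nonneg, div_le_one (by positivity)]
    linarith
  calc _ ≤ Real.exp (-(1 / (2 * P.n : ℝ))) ^ P.maxFailures := by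
        gcongr
        exact Real.one_sub_le_exp_neg _
    _ = _ := by
        rw [← Real.exp_nat_mul, maxFailures]
        congr 1
        push_cast
        field_simp

end Params

namespace LevelState

open PoolEntry

variable {n : ℕ}

/-- The loss of exponential weights is linear, hence it is the expected loss for the probabilities
that arise by inserting indicator functions for the losses. -/
theorem sum_mixedLoss_indicator_mul (η : ℝ) (s : LevelState n) (p h : Fin n → ℝ) :
    ∑ i, s.mixedLoss η (p i) (fun e => if e = i then 1 else 0) * h i =
      s.mixedLoss η (∑ i, p i * h i) h := by
  have hpool (pool : List (PoolEntry n)) :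
      ∑ i, (pool.map fun e => weight η e.cur * if e.expert = i then (1 : ℝ) else 0).sum * h i =
        (pool.map fun e => weight η e.cur * h e.expert).sum := by
    induction pool with
    | nil => simp
    | cons e pool ih =>
      simp only [List.map_cons, List.sum_cons, add_mul, sum_add_distrib, ih]
      simp
  simp only [mixedLoss, div_mul_eq_mul_div, add_mul, ← sum_div, sum_add_distrib, hpool, mul_assoc,
    ← mul_sum]

theorem accumulate_congr {a : ℕ} {l l' : Fin n → ℕ} {s : LevelState n}
    (h : ∀ e ∈ s.pool, l e.expert = l' e.expert) : s.accumulate a l = s.accumulate a l' := by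
  unfold accumulate
  congr 1
  exact List.map_congr_left fun e he => by simp only [addLoss, h e he]

theorem step_congr (q R E N t a : ℕ) {l l' : Fin n → ℕ} (x : Fin n) {s : LevelState n}
    (h : ∀ e ∈ s.pool, l e.expert = l' e.expert) :
    step q R E N t a l x s = step q R E N t a l' x s := by
  rw [step, step, accumulate_congr h]

theorem loss_congr (η : ℝ) (a : ℕ) {l l' : Fin n → ℕ} {s : LevelState n}
    (h : ∀ e ∈ s.pool, l e.expert = l' e.expert) : s.loss η a l = s.loss η a l' := by
  unfold loss mixedLoss
  congr 4
  exact List.map_congr_left fun e he => by simp only [h e he]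

end LevelState

namespace Params

open LevelState

variable (P : Params)

/-- The number of the day and the states of all levels. -/
abbrev Memory : Type := ℕ × (ℕ → LevelState P.n)

/-- The loss of the lowest `j` levels in states `s` on a day on which expert `i` has loss `l i`. -/
noncomputable def dayLoss (s : ℕ → LevelState P.n) (l : Fin P.n → ℕ) : ℕ → ℕ
  | 0 => l 0
  | j + 1 => (s j).loss (P.rate j) (dayLoss s l j) l

/-- The states of the levels after day `t`, where `x j` is the expert drawn by level `j`. -/
noncomputable def next (t : ℕ) (s : ℕ → LevelState P.n) (l : Fin P.n → ℕ) (x : ℕ → Fin P.n) :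
    ℕ → LevelState P.n := fun j =>
  if j < P.levels then
    step P.q (P.regretBound j) (P.epochLen j) P.epochs t (P.dayLoss s l j) l (x j) (s j)
  else ⟨0, []⟩

/-- The names of the experts in memory. -/
def experts (s : ℕ → LevelState P.n) : List (Fin P.n) :=
  0 :: (List.range P.levels).flatMap fun j => (s j).pool.map PoolEntry.expert

theorem zero_mem_experts (s : ℕ → LevelState P.n) : 0 ∈ P.experts s := List.mem_cons_self

variable {P}

theorem mem_experts {s : ℕ → LevelState P.n} {j : ℕ} (hj : j < P.levels) {e : PoolEntry P.n}
    (he : e ∈ (s j).pool) : e.expert ∈ P.experts s :=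
  List.mem_cons_of_mem _ (List.mem_flatMap.2 ⟨j, List.mem_range.2 hj, List.mem_map_of_mem he⟩)

theorem dayLoss_congr {s : ℕ → LevelState P.n} {l l' : Fin P.n → ℕ}
    (h : ∀ i ∈ P.experts s, l i = l' i) {j : ℕ} (hj : j ≤ P.levels) :
    P.dayLoss s l j = P.dayLoss s l' j := by
  induction j with
  | zero => exact h 0 (P.zero_mem_experts s)
  | succ j ih =>
    rw [dayLoss, dayLoss, ih (by omega)]
    exact loss_congr _ _ fun e he => h _ (mem_experts hj he)

theorem next_congr (t : ℕ) {s : ℕ → LevelState P.n} {l l' : Fin P.n → ℕ} (x : ℕ → Fin P.n)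
    (h : ∀ i ∈ P.experts s, l i = l' i) : P.next t s l x = P.next t s l' x := by
  funext j
  unfold next
  split_ifs with hj
  · rw [dayLoss_congr h hj.le]
    exact step_congr _ _ _ _ _ _ _ fun e he => h _ (mem_experts hj he)
  · rfl

variable (P)

/-- The probability with which the lowest `j` levels follow an expert. -/
noncomputable def followProb (s : ℕ → LevelState P.n) : ℕ → Fin P.n → ℝ
  | 0 => fun i => if i = 0 then 1 else 0
  | j + 1 => fun i =>
    (s j).mixedLoss (P.rate j) (followProb s j i) (fun e => if e = i then 1 else 0)

theorem followProb_nonneg (s : ℕ → LevelState P.n) (j : ℕ) (i : Fin P.n) :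
    0 ≤ P.followProb s j i := by
  induction j with
  | zero =>
    rw [followProb]
    positivity
  | succ j ih =>
    rw [followProb]
    exact mixedLoss_nonneg _ _ ih fun e => by positivity

theorem sum_followProb (s : ℕ → LevelState P.n) (j : ℕ) : ∑ i, P.followProb s j i = 1 := by
  induction j with
  | zero => simp [followProb]
  | succ j ih =>
    have hlinear := sum_mixedLoss_indicator_mul (P.rate j) (s j) (P.followProb s j) fun _ => 1
    simp only [mul_one, ih] at hlinear
    rw [followProb, hlinear]
    simp only [mixedLoss, mul_one]
    exact div_self (norm_pos _ _).ne'

theorem followProb_eq_zero {s : ℕ → LevelState P.n} {j : ℕ} (hj : j ≤ P.levels) {i : Fin P.n}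
    (hi : i ∉ P.experts s) : P.followProb s j i = 0 := by
  induction j with
  | zero => exact if_neg fun h : i = 0 => hi (h ▸ P.zero_mem_experts s)
  | succ j ih =>
    have hpool : ((s j).pool.map fun e => weight (P.rate j) e.cur *
        if e.expert = i then (1 : ℝ) else 0) = (s j).pool.map fun _ => 0 :=
      List.map_congr_left fun e he => by
        rw [if_neg fun h : e.expert = i => hi (h ▸ mem_experts hj he), mul_zero]
    simp only [followProb, mixedLoss, ih (by omega), hpool]
    simp

theorem sum_followProb_mul_le (s : ℕ → LevelState P.n) (l : Fin P.n → ℕ) (j : ℕ) :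
    ∑ i, P.followProb s j i * (l i : ℝ) ≤ P.dayLoss s l j := by
  induction j with
  | zero => simp [followProb, dayLoss]
  | succ j ih =>
    simp only [followProb, dayLoss]
    rw [sum_mixedLoss_indicator_mul]
    exact (mixedLoss_mono _ _ ih _).trans (Nat.le_ceil _)

theorem exists_follow (s : ℕ → LevelState P.n) :
    ∃ f : P.Block → {e // e ∈ (P.experts s).toFinset},
      ∀ h : Fin P.n → ℝ, (∀ i, 0 ≤ h i) → (∀ i, h i ≤ 1) →
        ∑ u, h (f u) ≤ Fintype.card P.Block * ∑ i, P.followProb s P.levels i * h i + P.n := by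
  have hsum (g : Fin P.n → ℝ) (hg : ∀ i ∉ P.experts s, g i = 0) :
      ∑ e : {e // e ∈ (P.experts s).toFinset}, g e = ∑ i, g i := by
    rw [sum_coe_sort (P.experts s).toFinset g]
    exact sum_subset (subset_univ _) fun i _ hi => hg i (by simpa using hi)
  have hzero (i) (hi : i ∉ P.experts s) : P.followProb s P.levels i = 0 :=
    P.followProb_eq_zero le_rfl hi
  have : Nonempty {e // e ∈ (P.experts s).toFinset} :=
    ⟨⟨0, List.mem_toFinset.2 (P.zero_mem_experts s)⟩⟩
  obtain ⟨f, hf⟩ := exists_map_sum_le (U := P.Block)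
    (p := fun e : {e // e ∈ (P.experts s).toFinset} => P.followProb s P.levels e)
    (fun e => P.followProb_nonneg s _ _) (by rw [hsum _ hzero, P.sum_followProb])
  refine ⟨f, fun h h0 h1 => (hf (fun e => h e) (fun e => h0 e) fun e => h1 e).trans ?_⟩
  rw [hsum (fun i => P.followProb s P.levels i * h i) fun i hi => by rw [hzero i hi, zero_mul],
    Fintype.card_coe]
  gcongr
  simpa using card_le_univ (P.experts s).toFinset

/-- The expert followed, as a function of the random bits. -/
noncomputable def follow (s : ℕ → LevelState P.n) : P.Block → {e // e ∈ (P.experts s).toFinset} :=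
  (P.exists_follow s).choose

end Params

theorem finOfNat_injOn (b : ℕ) [NeZero b] : Set.InjOn (Fin.ofNat b) (Set.Iio b) := by
  intro x hx y hy h
  simpa [Fin.ofNat, Nat.mod_eq_of_lt (Set.mem_Iio.1 hx), Nat.mod_eq_of_lt (Set.mem_Iio.1 hy)]
    using congrArg Fin.val h

theorem eq_of_forall_fin_map_getElem?_eq {α β : Type*} {f : α → β} {m : ℕ} {l l' : List α}
    (hl : l.length ≤ m) (hl' : l'.length ≤ m) (hf : ∀ x ∈ l, ∀ y ∈ l', f x = f y → x = y)
    (h : ∀ b : Fin m, l[b.val]?.map f = l'[b.val]?.map f) : l = l' := by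
  refine List.ext_getElem? fun b => ?_
  by_cases hb : b < m
  · have hb : l[b]?.map f = l'[b]?.map f := h ⟨b, hb⟩
    rcases hx : l[b]? with _ | x <;> rcases hy : l'[b]? with _ | y <;> rw [hx, hy] at hb
    · simp at hb
    · simp at hb
    · rw [hf x (List.mem_of_getElem? hx) y (List.mem_of_getElem? hy) (Option.some.inj hb)]
  · rw [List.getElem?_eq_none (by omega), List.getElem?_eq_none (by omega)]

namespace Params

open LevelState PoolEntry

variable (P : Params)

/-- A strict upper bound for all counters. -/
def counterBound : ℕ := P.epochs + P.epochs * P.regretBound P.levels + P.epochs ^ P.levels * P.T + 1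

/-- The maximal size of a pool. -/
def maxPool : ℕ := P.q * (2 * P.wordBits + 1) + 1

instance : NeZero P.counterBound := ⟨Nat.succ_ne_zero _⟩

/-- The counters of an entry are within their bounds. -/
def SmallEntry (e : PoolEntry P.n) : Prop :=
  e.age < P.counterBound ∧ e.gain < P.counterBound ∧ e.bench < P.counterBound ∧
    e.cur < P.counterBound

/-- The counters and the pool of a level are within their bounds. -/
def SmallLevel (s : LevelState P.n) : Prop :=
  s.lower < P.counterBound ∧ s.pool.length ≤ P.maxPool ∧ ∀ e ∈ s.pool, P.SmallEntry e

/-- All counters and pools are within their bounds. -/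
def Small (s : P.Memory) : Prop :=
  s.1 < P.T + 1 ∧ (∀ j < P.levels, P.SmallLevel (s.2 j)) ∧ ∀ j, P.levels ≤ j → s.2 j = ⟨0, []⟩

/-- The codes of entries. -/
abbrev EntryCode : Type :=
  Fin P.n × Fin P.counterBound × Fin P.counterBound × Fin P.counterBound × Fin P.counterBound

/-- The codes of the states of a level. -/
abbrev LevelCode : Type := Fin P.counterBound × (Fin P.maxPool → Option P.EntryCode)

/-- The codes of memory contents. -/
abbrev Code : Type := Fin (P.T + 1) × (Fin P.levels → P.LevelCode)

/-- The code of an entry; it determines the entry if the entry is small. -/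
def entryCode (e : PoolEntry P.n) : P.EntryCode :=
  (e.expert, Fin.ofNat _ e.age, Fin.ofNat _ e.gain, Fin.ofNat _ e.bench, Fin.ofNat _ e.cur)

/-- The code of the state of a level; it determines the state if the state is small. -/
def levelCode (s : LevelState P.n) : P.LevelCode :=
  (Fin.ofNat _ s.lower, fun b => s.pool[b.val]?.map P.entryCode)

/-- The code of a memory content; it determines the content if the content is small. -/
def code (s : P.Memory) : P.Code := (Fin.ofNat _ s.1, fun j => P.levelCode (s.2 j))

theorem entryCode_injOn : Set.InjOn P.entryCode {e | P.SmallEntry e} := by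
  rintro e ⟨hage, hgain, hbench, hcur⟩ e' ⟨hage', hgain', hbench', hcur'⟩ h
  simp only [entryCode, Prod.mk.injEq] at h
  obtain ⟨hexpert, hage_eq, hgain_eq, hbench_eq, hcur_eq⟩ := h
  have hinj := finOfNat_injOn P.counterBound
  exact PoolEntry.ext hexpert (hinj hage hage' hage_eq) (hinj hgain hgain' hgain_eq)
    (hinj hbench hbench' hbench_eq) (hinj hcur hcur' hcur_eq)

theorem levelCode_injOn : Set.InjOn P.levelCode {s | P.SmallLevel s} := by
  rintro s ⟨hlower, hlength, hpool⟩ s' ⟨hlower', hlength', hpool'⟩ h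
  obtain ⟨hlower_eq, hpool_eq⟩ := Prod.mk.inj h
  exact LevelState.ext (finOfNat_injOn _ hlower hlower' hlower_eq)
    (eq_of_forall_fin_map_getElem?_eq hlength hlength'
      (fun e he e' he' => P.entryCode_injOn (hpool e he) (hpool' e' he')) (congrFun hpool_eq))

theorem code_injOn : Set.InjOn P.code {s | P.Small s} := by
  rintro s ⟨hday, hlevels, hdefault⟩ s' ⟨hday', hlevels', hdefault'⟩ h
  obtain ⟨hday_eq, hlevels_eq⟩ := Prod.mk.inj h
  refine Prod.ext (finOfNat_injOn _ hday hday' hday_eq) (funext fun j => ?_)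
  by_cases hj : j < P.levels
  · exact P.levelCode_injOn (hlevels j hj) (hlevels' j hj) (congrFun hlevels_eq ⟨j, hj⟩)
  · rw [hdefault j (by omega), hdefault' j (by omega)]

/-- The number of bits in a code. -/
def codeLength : ℕ := Nat.clog 2 (Fintype.card P.Code)

theorem nonempty_code_embedding_bits : Nonempty (P.Code ↪ (Fin P.codeLength → Bool)) := by
  apply Function.Embedding.nonempty_of_card_le
  rw [Fintype.card_fun, Fintype.card_bool, Fintype.card_fin]
  exact Nat.le_pow_clog (by norm_num) _

/-- The code as a string of bits. -/
noncomputable def bits : P.Code ↪ (Fin P.codeLength → Bool) := P.nonempty_code_embedding_bits.some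

/-- The name of an expert as a word of memory. -/
def expertWord (e : Fin P.n) : Word P.n P.T := ⟨e.val, e.isLt.trans P.n_lt_two_pow_wordBits⟩

/-- A bit as a word of memory. -/
def bitWord (b : Bool) : Word P.n P.T :=
  ⟨b.toNat, b.toNat_lt.trans_le (Nat.le_pow P.wordBits_pos)⟩

theorem bitWord_injective : Function.Injective P.bitWord := by
  rintro (_ | _) (_ | _) h <;> simp_all [bitWord]

/-- The words of memory: the names of the experts and the bits of the code. -/
noncomputable def memoryWords (s : P.Memory) : List (Word P.n P.T) :=
  (P.experts s.2).map P.expertWord ++ List.ofFn fun b => P.bitWord (P.bits (P.code s) b)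

theorem memoryWords_injOn : Set.InjOn P.memoryWords {s | P.Small s} := by
  intro s hs s' hs' h
  have hbits := List.ofFn_injective (List.append_inj_right' h (by simp))
  exact P.code_injOn hs hs' (P.bits.injective (P.bitWord_injective.comp_left hbits))

theorem small_default : P.Small (0, fun _ => ⟨0, []⟩) :=
  ⟨Nat.succ_pos _, fun _ _ => ⟨Nat.succ_pos _, Nat.zero_le _, by simp⟩, fun _ _ => rfl⟩

open scoped Classical in
/-- Memory contents that are too large are replaced by a default value. -/
noncomputable def clip (s : P.Memory) : {s : P.Memory // P.Small s} :=
  if h : P.Small s then ⟨s, h⟩ else ⟨_, P.small_default⟩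

variable {P} in
theorem clip_of_small {s : P.Memory} (hs : P.Small s) : P.clip s = ⟨s, hs⟩ := dif_pos hs

/-- The blocks of random bits of a day. -/
def dayBlocks : (Fin ((P.levels + 1) * P.wordBits) → Bool) ≃ (Fin (P.levels + 1) → P.Block) :=
  (Equiv.arrowCongr finProdFinEquiv.symm (Equiv.refl Bool)).trans (Equiv.curry _ _ _)

/-- The blocks of random bits of a run. -/
def tapeBlocks : (Fin (P.T + 1) → Fin ((P.levels + 1) * P.wordBits) → Bool) ≃ P.Blocks :=
  (Equiv.piCongrRight fun _ => P.dayBlocks).trans (Equiv.curry _ _ _).symm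

/-- The expert drawn by level `j` from the random bits of a day. -/
noncomputable def drawBits (w : Fin ((P.levels + 1) * P.wordBits) → Bool) (j : ℕ) : Fin P.n :=
  if hj : j < P.levels then P.draw (P.dayBlocks w ⟨j + 1, by omega⟩) else 0

/-- The initial memory content. -/
noncomputable def initial (w : Fin ((P.levels + 1) * P.wordBits) → Bool) : P.Memory :=
  (0, fun j => if j < P.levels then ⟨0, [fresh (P.drawBits w j)]⟩ else ⟨0, []⟩)

/-- The losses of the queried experts, rounded to multiples of `1 / T`. -/
noncomputable def quantize (S : Finset (Fin P.n)) (l : {e // e ∈ S} → unitInterval)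
    (e : Fin P.n) : ℕ :=
  if h : e ∈ S then ⌊(P.T : ℝ) * l ⟨e, h⟩⌋₊ else 0

/-- The algorithm for `n` experts and `T` days. -/
noncomputable def algorithm : ExpertAlgorithm P.n P.T where
  State := {s : P.Memory // P.Small s}
  words s := P.memoryWords s.1
  words_injective s s' h := Subtype.ext (P.memoryWords_injOn s.2 s'.2 h)
  query s := (P.experts s.1.2).toFinset
  query_stored _ e he :=
    ⟨P.expertWord e, List.mem_append_left _ (List.mem_map_of_mem (List.mem_toFinset.1 he)), rfl⟩
  numBits := (P.levels + 1) * P.wordBits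
  init w := P.clip (P.initial w)
  play s _ w := P.follow s.1.2 (P.dayBlocks w 0)
  update s _ l w := P.clip (s.1.1 + 1, P.next s.1.1 s.1.2 (P.quantize _ l) (P.drawBits w))

/-- The memory content at the beginning of day `t`. -/
noncomputable def memory (l : ℕ → Fin P.n → ℕ) (X : ℕ → ℕ → Fin P.n) (t : ℕ) : P.Memory :=
  (t, fun j => if j < P.levels then P.levelState l X j t else ⟨0, []⟩)

theorem memory_eq_levelState (l : ℕ → Fin P.n → ℕ) (X : ℕ → ℕ → Fin P.n) (t : ℕ) {j : ℕ}
    (hj : j < P.levels) : (P.memory l X t).2 j = P.levelState l X j t := if_pos hj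

theorem dayLoss_memory (l : ℕ → Fin P.n → ℕ) (X : ℕ → ℕ → Fin P.n) (t : ℕ) {j : ℕ}
    (hj : j ≤ P.levels) : P.dayLoss (P.memory l X t).2 (l t) j = P.levelLoss l X j t := by
  induction j with
  | zero => rfl
  | succ j ih =>
    rw [dayLoss, ih (by omega), levelLoss, P.memory_eq_levelState l X t hj]
    rfl

theorem next_memory (l : ℕ → Fin P.n → ℕ) (X : ℕ → ℕ → Fin P.n) (t : ℕ) {x : ℕ → Fin P.n}
    (hx : ∀ j < P.levels, x j = X j (t + 1)) :
    P.next t (P.memory l X t).2 (l t) x = (P.memory l X (t + 1)).2 := by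
  funext j
  by_cases hj : j < P.levels
  · rw [next, if_pos hj, P.dayLoss_memory l X t hj.le, hx j hj, P.memory_eq_levelState l X t hj,
      P.memory_eq_levelState l X (t + 1) hj]
    rfl
  · simp [next, memory, hj]

theorem regretBound_mono : Monotone P.regretBound := fun i j h => by
  have := P.n_pos
  have := P.wordBits_pos
  exact Nat.mul_le_mul_left _ (Nat.pow_le_pow_right (by positivity) h)

theorem sum_range_lt_counterBound {f : ℕ → ℕ} (hf : ∀ k, f k ≤ P.T) {j r : ℕ} (hj : j < P.levels)
    (hr : r < P.epochLen j) : ∑ k ∈ range r, f k < P.counterBound := by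
  have hrT : r * P.T ≤ P.epochs ^ P.levels * P.T :=
    Nat.mul_le_mul_right _ (hr.le.trans (Nat.pow_le_pow_right P.epochs_pos hj))
  have hsum : ∑ k ∈ range r, f k ≤ r * P.T := by
    simpa using sum_le_card_nsmul (range r) f P.T fun k _ => hf k
  unfold counterBound
  omega

theorem length_instancePool_le_maxPool (a : ℕ → ℕ) (l : ℕ → Fin P.n → ℕ) (X : ℕ → Fin P.n)
    (j d : ℕ) {s : ℕ} (hs : s ≤ P.epochs) :
    (instancePool P.q (P.regretBound j) (P.epochLen j) a l X d s).length ≤ P.maxPool := by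
  have hlength := length_instancePool_le P.q _ (P.epochLen j) P.epochs a l X (P.regretBound_pos j)
    d hs
  have hlog : (P.q : ℝ) * (1 + Real.log P.epochs) ≤ P.q * (2 * P.wordBits + 1) :=
    mul_le_mul_of_nonneg_left (by linarith [P.log_epochs_le]) P.q.cast_nonneg
  rw [← Nat.cast_le (α := ℝ), maxPool]
  push_cast
  linarith

theorem smallLevel_levelState {l : ℕ → Fin P.n → ℕ} (hl : ∀ t i, l t i ≤ P.T)
    (X : ℕ → ℕ → Fin P.n) {j : ℕ} (hj : j < P.levels) (t : ℕ) :
    P.SmallLevel (P.levelState l X j t) := by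
  have hperiod : 0 < P.epochLen j * P.epochs := Nat.mul_pos (P.epochLen_pos j) P.epochs_pos
  obtain ⟨d, s, r, hd, hs, hr, rfl⟩ : ∃ d s r, P.epochLen j * P.epochs ∣ d ∧ s < P.epochs ∧
      r < P.epochLen j ∧ t = d + s * P.epochLen j + r := by
    refine ⟨P.epochLen j * P.epochs * (t / (P.epochLen j * P.epochs)),
      t % (P.epochLen j * P.epochs) / P.epochLen j, t % (P.epochLen j * P.epochs) % P.epochLen j,
      dvd_mul_right _ _, Nat.div_lt_of_lt_mul (Nat.mod_lt _ hperiod),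
      Nat.mod_lt _ (P.epochLen_pos j), ?_⟩
    rw [add_assoc, Nat.div_add_mod', Nat.div_add_mod]
  rw [levelState, run_day _ _ _ _ _ _ _ (P.epochLen_pos j) hd hs hr]
  have hregret : s * P.regretBound j ≤ P.epochs * P.regretBound P.levels :=
    Nat.mul_le_mul hs.le (P.regretBound_mono hj.le)
  refine ⟨P.sum_range_lt_counterBound (fun _ => P.levelLoss_le hl X j _) hj hr, ?_, fun e he => ?_⟩
  · simpa only [during, List.length_map] using
      P.length_instancePool_le_maxPool (P.levelLoss l X j) l (X j) j d hs.le
  · obtain ⟨e, he₀, rfl⟩ := List.mem_map.1 he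
    obtain ⟨hage, hgain, hbench⟩ :=
      Pool.records_le_of_mem_pool _ _ _ (fun _ _ => min_le_left _ _) he₀
    have hcur := P.sum_range_lt_counterBound
      (f := fun k => l (d + s * P.epochLen j + k) e.expert) (fun _ => hl _ _) hj hr
    refine ⟨?_, ?_, ?_, ?_⟩
    · simp only [addLoss, counterBound]; omega
    · simp only [addLoss, counterBound]; omega
    · simp only [addLoss, counterBound]; omega
    · simpa only [addLoss, cur_eq_zero_of_mem_pool _ _ _ he₀, zero_add] using hcur

theorem small_memory {l : ℕ → Fin P.n → ℕ} (hl : ∀ t i, l t i ≤ P.T)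
    (X : ℕ → ℕ → Fin P.n) {t : ℕ} (ht : t ≤ P.T) : P.Small (P.memory l X t) := by
  refine ⟨Nat.lt_succ_of_le ht, fun j hj => ?_, fun j hj => if_neg hj.not_gt⟩
  rw [P.memory_eq_levelState l X t hj]
  exact P.smallLevel_levelState hl X hj t

/-- The losses, rounded to multiples of `1 / T` and extended by zero. -/
noncomputable def roundedLoss (l : Fin P.T → Fin P.n → unitInterval) (t : ℕ) (i : Fin P.n) : ℕ :=
  if h : t < P.T then ⌊(P.T : ℝ) * l ⟨t, h⟩ i⌋₊ else 0

theorem roundedLoss_le (l : Fin P.T → Fin P.n → unitInterval) (t : ℕ) (i : Fin P.n) :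
    P.roundedLoss l t i ≤ P.T := by
  unfold roundedLoss
  split_ifs with ht
  · exact Nat.floor_le_of_le (mul_le_of_le_one_right P.T.cast_nonneg (l _ i).2.2)
  · exact Nat.zero_le _

theorem roundedLoss_eq_zero (l : Fin P.T → Fin P.n → unitInterval) {t : ℕ} (ht : P.T ≤ t)
    (i : Fin P.n) : P.roundedLoss l t i = 0 := dif_neg ht.not_gt

theorem drawBits_eq_drawn (ω : P.algorithm.Tape) (d : Fin (P.T + 1)) {j : ℕ} (hj : j < P.levels) :
    P.drawBits (ω d) j = P.drawn (P.tapeBlocks ω) j d := by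
  have hblock : P.drawBlock hj d = (d, ⟨j + 1, by omega⟩) := by
    simp [drawBlock, min_eq_left (Nat.lt_succ_iff.1 d.isLt)]
  simp only [drawBits, drawn, dif_pos hj, hblock]
  rfl

theorem initial_eq_memory (l : ℕ → Fin P.n → ℕ) (ω : P.algorithm.Tape) :
    P.initial (ω 0) = P.memory l (P.drawn (P.tapeBlocks ω)) 0 := by
  refine Prod.ext rfl (funext fun j => ?_)
  simp only [initial, memory]
  split_ifs with hj
  · rw [P.drawBits_eq_drawn ω 0 hj]
    rfl
  · rfl

theorem quantize_eq_roundedLoss (l : Fin P.T → Fin P.n → unitInterval) (t : Fin P.T)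
    {S : Finset (Fin P.n)} {i : Fin P.n} (hi : i ∈ S) :
    P.quantize S (fun e => l t e) i = P.roundedLoss l t i := by
  rw [quantize, roundedLoss, dif_pos hi, dif_pos t.2]

theorem state_eq_memory (x l : Fin P.T → Fin P.n → unitInterval) (ω : P.algorithm.Tape)
    (t : Fin (P.T + 1)) : (P.algorithm.state x l ω t).1 =
      P.memory (P.roundedLoss l) (P.drawn (P.tapeBlocks ω)) t := by
  have hsmall {t} (ht : t ≤ P.T) :=
    P.small_memory (P.roundedLoss_le l) (P.drawn (P.tapeBlocks ω)) ht
  induction t using Fin.induction with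
  | zero =>
    have hinit : P.algorithm.state x l ω 0 = P.clip (P.initial (ω 0)) := rfl
    rw [hinit, P.initial_eq_memory (P.roundedLoss l), clip_of_small (hsmall P.T.zero_le)]
    rfl
  | succ t ih =>
    have hupdate : P.algorithm.state x l ω t.succ =
        P.algorithm.update (P.algorithm.state x l ω t.castSucc) (fun e => x t e) (fun e => l t e)
          (ω t.succ) := rfl
    rw [hupdate]
    generalize P.algorithm.state x l ω t.castSucc = s at ih
    have hnext : P.next s.1.1 s.1.2 (P.quantize (P.experts s.1.2).toFinset fun e => l t e)
        (P.drawBits (ω t.succ)) =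
        (P.memory (P.roundedLoss l) (P.drawn (P.tapeBlocks ω)) (t + 1)).2 := by
      rw [next_congr (l' := P.roundedLoss l t) _ _ fun i hi =>
        P.quantize_eq_roundedLoss l t (List.mem_toFinset.2 hi), ih]
      exact P.next_memory _ _ t fun j hj => P.drawBits_eq_drawn ω t.succ hj
    have hmemory : (s.1.1 + 1, P.next s.1.1 s.1.2 (P.quantize (P.experts s.1.2).toFinset
        fun e => l t e) (P.drawBits (ω t.succ))) =
        P.memory (P.roundedLoss l) (P.drawn (P.tapeBlocks ω)) (t + 1) := by
      rw [hnext, ih]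
      rfl
    simp only [algorithm]
    rw [hmemory, clip_of_small (hsmall t.2)]
    rfl

theorem played_eq_follow (x l : Fin P.T → Fin P.n → unitInterval) (ω : P.algorithm.Tape)
    (t : Fin P.T) :
    P.algorithm.played x l ω t = (P.follow (P.memory (P.roundedLoss l)
      (P.drawn (P.tapeBlocks ω)) t).2 (P.tapeBlocks ω (P.playBlock t))).1 := by
  have hblock : P.playBlock t = (t.succ, 0) := Prod.ext (Fin.ext (min_eq_left t.2)) rfl
  have hplayed : P.algorithm.played x l ω t = (P.follow (P.algorithm.state x l ω t.castSucc).1.2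
    (P.tapeBlocks ω (t.succ, 0))).1 := rfl
  rw [hplayed, state_eq_memory, hblock]
  rfl

end Params

namespace ExpertAlgorithm

variable {n T : ℕ} (A : ExpertAlgorithm n T)

theorem prob_nonneg (S : Set A.Tape) : 0 ≤ A.prob S := MeasureTheory.measureReal_nonneg

theorem prob_eq_one {S : Set A.Tape} (h : ∀ ω, ω ∈ S) : A.prob S = 1 := by
  rw [Set.eq_univ_of_forall h]
  exact MeasureTheory.probReal_univ

theorem prob_mono {S S' : Set A.Tape} (h : S ⊆ S') : A.prob S ≤ A.prob S' :=
  MeasureTheory.measureReal_mono h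

theorem one_sub_le_prob {β : Type*} [Fintype β] (φ : A.Tape ≃ β) {S : Set A.Tape} {B : Finset β}
    (hB : ∀ ω, φ ω ∉ B → ω ∈ S) {ε : ℝ} (hcard : (#B : ℝ) ≤ ε * Fintype.card β) :
    1 - ε ≤ A.prob S := by
  classical
  have hpos : (0 : ℝ) < Fintype.card A.Tape := by exact_mod_cast Fintype.card_pos
  have hprob : A.prob S = (#{ω : A.Tape | ω ∈ S} : ℝ) / Fintype.card A.Tape := by
    rw [prob, MeasureTheory.measureReal_def,
      PMF.toMeasure_uniformOfFintype_apply _ S.toFinite.measurableSet,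
      ENNReal.toReal_div, ENNReal.toReal_natCast, ENNReal.toReal_natCast, Fintype.card_subtype]
  have hcover : Fintype.card A.Tape ≤ #{ω : A.Tape | ω ∈ S} + #B := by
    rw [← card_univ, ← card_map φ.symm.toEmbedding (s := B)]
    refine (card_le_card fun ω _ => ?_).trans (card_union_le _ _)
    by_cases hω : φ ω ∈ B
    · simp [hω]
    · simp [hB ω hω]
  rw [← Fintype.card_congr φ] at hcard
  rw [hprob, le_div_iff₀ hpos]
  have hcover' : (Fintype.card A.Tape : ℝ) ≤ #{ω : A.Tape | ω ∈ S} + #B := by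
    exact_mod_cast hcover
  linarith

theorem regret_le (x l : Fin T → Fin n → unitInterval) (ω : A.Tape) : A.regret x l ω ≤ T := by
  have hplayed : ∑ t, (l t (A.played x l ω t) : ℝ) ≤ T := by
    simpa using sum_le_card_nsmul univ (fun t => (l t (A.played x l ω t) : ℝ)) 1
      fun t _ => (l t _).2.2
  have hbest : 0 ≤ ⨅ i : Fin n, ∑ t, (l t i : ℝ) :=
    Real.iInf_nonneg fun i => sum_nonneg fun t _ => (l t i).2.1
  rw [regret]
  linarith

end ExpertAlgorithm

namespace Params

open LevelState Pool

variable (P : Params)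

/-- A number of bits that suffices for every counter. -/
def counterBits : ℕ := 7 * P.wordBits * (P.levels + 1)

theorem epochs_le_two_pow : P.epochs ≤ 2 ^ (2 * P.wordBits) := by
  rw [mul_comm, pow_mul]
  exact P.epochs_le.trans (Nat.pow_le_pow_left P.n_lt_two_pow_wordBits.le 2)

theorem ten_mul_wordBits_sq_le : 10 * P.wordBits ^ 2 ≤ 2 ^ (6 * P.wordBits) := by
  have hten : 10 ≤ 2 ^ (4 * P.wordBits) :=
    (by norm_num : 10 ≤ 2 ^ 4).trans (Nat.pow_le_pow_right two_pos (by linarith [P.wordBits_pos]))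
  calc 10 * P.wordBits ^ 2 ≤ 2 ^ (4 * P.wordBits) * (2 ^ P.wordBits) ^ 2 :=
        Nat.mul_le_mul hten (Nat.pow_le_pow_left Nat.lt_two_pow_self.le 2)
    _ = 2 ^ (6 * P.wordBits) := by ring

theorem regretBound_levels_le :
    P.regretBound P.levels ≤ 2 ^ (3 * P.wordBits + 7 * P.wordBits * P.levels) := by
  have hepochs := P.epochs_le_two_pow
  have hT := P.T_lt_two_pow_wordBits.le
  have hn := P.n_lt_two_pow_wordBits.le
  have hten := P.ten_mul_wordBits_sq_le
  calc P.regretBound P.levels ≤ 2 ^ (2 * P.wordBits) * 2 ^ P.wordBits *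
        (2 ^ P.wordBits * 2 ^ (6 * P.wordBits)) ^ P.levels := by
        unfold regretBound
        gcongr
    _ = 2 ^ (3 * P.wordBits + 7 * P.wordBits * P.levels) := by
        simp only [← pow_add, ← pow_mul]
        congr 1
        ring

theorem counterBound_le : P.counterBound ≤ 2 ^ P.counterBits := by
  have hwordBits := P.wordBits_pos
  set b := 5 * P.wordBits + 7 * P.wordBits * P.levels with hb
  have hregret : P.epochs * P.regretBound P.levels ≤ 2 ^ b := by
    calc _ ≤ 2 ^ (2 * P.wordBits) * 2 ^ (3 * P.wordBits + 7 * P.wordBits * P.levels) :=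
          Nat.mul_le_mul P.epochs_le_two_pow P.regretBound_levels_le
      _ = 2 ^ b := by rw [← pow_add]; congr 1; omega
  have hloss : P.epochs ^ P.levels * P.T ≤ 2 ^ b := by
    calc _ ≤ 2 ^ P.wordBits * 2 ^ P.wordBits :=
          Nat.mul_le_mul ((Nat.pow_log_le_self _ P.T_pos.ne').trans P.T_lt_two_pow_wordBits.le)
            P.T_lt_two_pow_wordBits.le
      _ = 2 ^ (P.wordBits + P.wordBits) := (pow_add _ _ _).symm
      _ ≤ 2 ^ b := Nat.pow_le_pow_right two_pos (by omega)
  have hepochs : P.epochs ≤ 2 ^ b :=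
    P.epochs_le_two_pow.trans (Nat.pow_le_pow_right two_pos (by omega))
  calc P.counterBound ≤ 2 ^ 2 * 2 ^ b := by
        have := Nat.one_le_two_pow (n := b)
        unfold counterBound
        omega
    _ = 2 ^ (2 + b) := (pow_add _ _ _).symm
    _ ≤ 2 ^ P.counterBits := Nat.pow_le_pow_right two_pos (by unfold counterBits; linarith)

theorem card_option_entryCode_le :
    Fintype.card (Option P.EntryCode) ≤ 2 ^ (P.wordBits + 4 * P.counterBits + 1) := by
  have hV := P.counterBound_le
  have hn := P.n_lt_two_pow_wordBits.le
  have hentry : Fintype.card P.EntryCode ≤ 2 ^ (P.wordBits + 4 * P.counterBits) := by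
    calc Fintype.card P.EntryCode = P.n * P.counterBound ^ 4 := by
          simp only [Fintype.card_prod, Fintype.card_fin]
          ring
      _ ≤ 2 ^ P.wordBits * (2 ^ P.counterBits) ^ 4 := by gcongr
      _ = 2 ^ (P.wordBits + 4 * P.counterBits) := by ring
  have := Nat.one_le_two_pow (n := P.wordBits + 4 * P.counterBits)
  rw [Fintype.card_option, pow_succ]
  omega

theorem codeLength_le : P.codeLength ≤ P.wordBits + P.levels * (P.counterBits +
    P.maxPool * (P.wordBits + 4 * P.counterBits + 1)) := by
  have hV := P.counterBound_le
  have hT : P.T + 1 ≤ 2 ^ P.wordBits := P.T_lt_two_pow_wordBits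
  have hentry := P.card_option_entryCode_le
  refine Nat.clog_le_of_le_pow ?_
  calc Fintype.card P.Code = (P.T + 1) * (P.counterBound *
        Fintype.card (Option P.EntryCode) ^ P.maxPool) ^ P.levels := by simp
    _ ≤ 2 ^ P.wordBits * (2 ^ P.counterBits *
        (2 ^ (P.wordBits + 4 * P.counterBits + 1)) ^ P.maxPool) ^ P.levels := by gcongr
    _ = _ := by
        simp only [← pow_mul, ← pow_add]
        congr 1
        ring

variable {P} in
theorem length_experts_le {s : P.Memory} (hs : P.Small s) :
    (P.experts s.2).length ≤ 1 + P.levels * P.maxPool := by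
  have hsum := List.sum_le_card_nsmul ((List.range P.levels).map fun j => (s.2 j).pool.length)
    P.maxPool (by
      simp only [List.mem_map, List.mem_range]
      rintro _ ⟨j, hj, rfl⟩
      exact (hs.2.1 j hj).2.1)
  simp only [List.length_map, List.length_range, smul_eq_mul] at hsum
  simp only [experts, List.length_cons, List.length_flatMap, List.length_map]
  omega

theorem length_memoryWords_le {s : P.Memory} (hs : P.Small s) {c : ℕ} (hc : P.levels ≤ c) :
    (P.memoryWords s).length ≤ (2 + 4 * c + 127 * c * (c + 1)) * (P.q * P.wordBits ^ 2) := by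
  have hq : 1 ≤ P.q := P.q_pos
  have hwordBits : 1 ≤ P.wordBits := P.wordBits_pos
  have hmaxPool : P.maxPool ≤ 4 * (P.q * P.wordBits) := by
    unfold maxPool
    nlinarith [Nat.mul_le_mul hq hwordBits]
  have hcounter : P.counterBits ≤ 7 * P.wordBits * (c + 1) := by
    unfold counterBits
    gcongr
  have hentry : P.wordBits + 4 * P.counterBits + 1 ≤ 30 * P.wordBits * (c + 1) := by nlinarith
  have hqL : P.q * P.wordBits ≤ P.q * P.wordBits ^ 2 :=
    Nat.mul_le_mul_left _ (Nat.le_self_pow two_ne_zero _)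
  have hL : P.wordBits ≤ P.q * P.wordBits ^ 2 := (Nat.le_mul_of_pos_left _ hq).trans hqL
  calc (P.memoryWords s).length = (P.experts s.2).length + P.codeLength := by simp [memoryWords]
    _ ≤ (1 + P.levels * P.maxPool) + (P.wordBits + P.levels * (P.counterBits +
          P.maxPool * (P.wordBits + 4 * P.counterBits + 1))) :=
        add_le_add (length_experts_le hs) P.codeLength_le
    _ ≤ (1 + c * (4 * (P.q * P.wordBits))) + (P.wordBits + c * (7 * P.wordBits * (c + 1) +
          4 * (P.q * P.wordBits) * (30 * P.wordBits * (c + 1)))) := by gcongr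
    _ = 1 + 4 * c * (P.q * P.wordBits) + P.wordBits + 7 * c * (c + 1) * P.wordBits +
          120 * c * (c + 1) * (P.q * P.wordBits ^ 2) := by ring
    _ ≤ P.q * P.wordBits ^ 2 + 4 * c * (P.q * P.wordBits ^ 2) + P.q * P.wordBits ^ 2 +
          7 * c * (c + 1) * (P.q * P.wordBits ^ 2) +
          120 * c * (c + 1) * (P.q * P.wordBits ^ 2) := by
        gcongr
        exact hwordBits.trans hL
    _ = _ := by ring

variable {P} in
theorem levels_le {c : ℕ} (h : P.T ≤ P.n ^ c) : P.levels ≤ c := by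
  rcases Nat.lt_or_ge 1 P.n with hn | hn
  · refine (Nat.pow_le_pow_iff_right hn).1 ?_
    calc P.n ^ P.levels ≤ P.epochs ^ P.levels :=
          Nat.pow_le_pow_left (Nat.le_mul_of_pos_right _ P.q_pos) _
      _ ≤ P.T := Nat.pow_log_le_self _ P.T_pos.ne'
      _ ≤ P.n ^ c := h
  · have hepochs : P.epochs ≤ 1 := P.epochs_le.trans (pow_le_one' hn 2)
    rw [levels, Nat.log_of_left_le_one hepochs]
    exact Nat.zero_le _

/-- The rounded loss of the expert followed on day `t`, as a fraction of the maximal loss. -/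
noncomputable def followedLoss (l : ℕ → Fin P.n → ℕ) (t : ℕ) (ψ : P.Blocks) : ℝ :=
  (l t (P.follow (P.memory l (P.drawn ψ) t).2 (ψ (P.playBlock t))) : ℝ) / P.T

theorem playBlock_injOn : Set.InjOn P.playBlock (Set.Iio P.T) := by
  intro s hs t ht h
  have hday := congrArg (fun c : P.BlockIndex => c.1.val) h
  simp only [playBlock, Set.mem_Iio] at hday hs ht
  omega

theorem dependsOn_followedLoss (l : ℕ → Fin P.n → ℕ) {s t : ℕ} (hst : s < t) (ht : t < P.T) :
    DependsOn (P.followedLoss l s) {P.playBlock t}ᶜ := by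
  intro ψ ψ' h
  have hblock : ψ (P.playBlock s) = ψ' (P.playBlock s) := h _ fun heq =>
    hst.ne (P.playBlock_injOn (hst.trans ht) ht heq)
  rw [followedLoss, followedLoss, P.dependsOn_drawn t h, hblock]

/-- The play block of a day is independent of the memory content, so averaging over it replaces
the loss of the followed expert by the mixed loss, up to the error `n / 2 ^ wordBits ≤ 1 / T` of
sampling from finitely many bits. -/
theorem sum_followedLoss_update_le {l : ℕ → Fin P.n → ℕ} (hl : ∀ t i, l t i ≤ P.T) (t : ℕ)
    (ψ : P.Blocks) : ∑ u, P.followedLoss l t (update ψ (P.playBlock t) u) ≤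
      Fintype.card P.Block * ((P.levelLoss l (P.drawn ψ) P.levels t : ℝ) / P.T + 1 / P.T) := by
  have hT : (0 : ℝ) < P.T := by exact_mod_cast P.T_pos
  set s := (P.memory l (P.drawn ψ) t).2 with hs
  have hupdate (u : P.Block) :
      P.followedLoss l t (update ψ (P.playBlock t) u) = (l t (P.follow s u) : ℝ) / P.T := by
    rw [followedLoss, apply_update_of_dependsOn (P.dependsOn_drawn t) ψ u, update_self]
  have hfollow := (P.exists_follow s).choose_spec (fun i => (l t i : ℝ) / P.T)
    (fun i => by positivity) fun i => (div_le_one hT).2 (by exact_mod_cast hl t i)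
  have hmean : ∑ i, P.followProb s P.levels i * ((l t i : ℝ) / P.T) ≤
      P.levelLoss l (P.drawn ψ) P.levels t / P.T := by
    have hsum := P.sum_followProb_mul_le s (l t) P.levels
    rw [hs, P.dayLoss_memory l (P.drawn ψ) t le_rfl, ← hs] at hsum
    simp only [← mul_div_assoc, ← sum_div]
    gcongr
  have herror : (P.n : ℝ) ≤ Fintype.card P.Block * (1 / P.T) := by
    rw [mul_one_div, le_div_iff₀ hT]
    exact_mod_cast P.mul_le_card_block
  simp only [hupdate]
  rw [mul_add]
  exact hfollow.trans (add_le_add (mul_le_mul_of_nonneg_left hmean (Nat.cast_nonneg _)) herror)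

open scoped Classical in
theorem card_lt_sum_followedLoss_le {l : ℕ → Fin P.n → ℕ} (hl : ∀ t i, l t i ≤ P.T) :
    (#{ψ : P.Blocks | (∑ t ∈ range P.T, (P.levelLoss l (P.drawn ψ) P.levels t : ℝ)) / P.T + 1 +
      √P.T * (1 + P.wordBits ^ 2) < ∑ t ∈ range P.T, P.followedLoss l t ψ} : ℝ) ≤
      Real.exp (-(P.wordBits : ℝ) ^ 2) * Fintype.card P.Blocks := by
  have hT : (1 : ℝ) ≤ P.T := by exact_mod_cast P.T_pos
  have hsqrt : 0 < √(P.T : ℝ) := by positivity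
  have hthreshold (ψ : P.Blocks) :
      (∑ t ∈ range P.T, (P.levelLoss l (P.drawn ψ) P.levels t : ℝ)) / P.T + 1 +
        √P.T * (1 + P.wordBits ^ 2) =
      ∑ t ∈ range P.T, ((P.levelLoss l (P.drawn ψ) P.levels t : ℝ) / P.T + 1 / P.T) +
        1 / √P.T * P.T + (P.wordBits : ℝ) ^ 2 / (1 / √P.T) := by
    rw [sum_add_distrib, ← sum_div, sum_const, card_range, nsmul_eq_mul,
      mul_one_div_cancel (by positivity), one_div_mul_eq_div, Real.div_sqrt]
    field_simp
    ring
  simp only [hthreshold]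
  refine card_add_lt_sum_le (by positivity)
    ((div_le_one hsqrt).2 (Real.one_le_sqrt.2 hT)) (c := P.playBlock)
    (fun _ _ _ => div_nonneg (Nat.cast_nonneg _) (Nat.cast_nonneg _))
    (fun t _ ψ => (div_le_one (by positivity)).2 (by exact_mod_cast hl _ _))
    (fun s t _ _ ψ ψ' h => ?_) (fun s t => P.dependsOn_followedLoss l)
    (fun t _ => P.sum_followedLoss_update_le hl t) _
  rw [P.dependsOn_drawn t h]

theorem followedLoss_tapeBlocks (x l : Fin P.T → Fin P.n → unitInterval) (ω : P.algorithm.Tape)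
    (t : Fin P.T) : P.followedLoss (P.roundedLoss l) t (P.tapeBlocks ω) =
      (P.roundedLoss l t (P.algorithm.played x l ω t) : ℝ) / P.T := by
  rw [played_eq_follow, followedLoss]

theorem roundedLoss_cast_le (l : Fin P.T → Fin P.n → unitInterval) (t : Fin P.T) (i : Fin P.n) :
    (P.roundedLoss l t i : ℝ) ≤ P.T * l t i := by
  rw [roundedLoss, dif_pos t.2]
  exact Nat.floor_le (mul_nonneg P.T.cast_nonneg (l t i).2.1)

theorem mul_le_roundedLoss_add_one (l : Fin P.T → Fin P.n → unitInterval) (t : Fin P.T)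
    (i : Fin P.n) : P.T * (l t i : ℝ) ≤ P.roundedLoss l t i + 1 := by
  rw [roundedLoss, dif_pos t.2]
  exact (Nat.lt_floor_add_one _).le

theorem sum_played_le (x l : Fin P.T → Fin P.n → unitInterval) (ω : P.algorithm.Tape) :
    ∑ t, (l t (P.algorithm.played x l ω t) : ℝ) ≤
      ∑ t ∈ range P.T, P.followedLoss (P.roundedLoss l) t (P.tapeBlocks ω) + 1 := by
  have hT : (0 : ℝ) < P.T := by exact_mod_cast P.T_pos
  have hone : ∑ _t : Fin P.T, (1 : ℝ) / P.T = 1 := by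
    simp [hT.ne']
  rw [← Fin.sum_univ_eq_sum_range
    (fun t => P.followedLoss (P.roundedLoss l) t (P.tapeBlocks ω)), ← hone, ← sum_add_distrib]
  refine sum_le_sum fun t _ => ?_
  rw [P.followedLoss_tapeBlocks x, ← add_div, le_div_iff₀ hT, mul_comm]
  exact P.mul_le_roundedLoss_add_one l t _

/-- The bound for the regret of the algorithm. Besides the regret of the levels it accounts for
the rounding of the losses, the error of sampling, and the deviation of the loss from its mean. -/
noncomputable def totalRegretBound : ℝ :=
  (P.regretBound P.levels : ℝ) / P.T + 2 + √P.T * (1 + P.wordBits ^ 2)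

variable {P} in
theorem regret_le_totalRegretBound (hn : 1 < P.n) {x l : Fin P.T → Fin P.n → unitInterval}
    {ω : P.algorithm.Tape} {i : Fin P.n}
    (hi : ∑ t, (l t i : ℝ) = ⨅ i : Fin P.n, ∑ t, (l t i : ℝ))
    (hfail : ∀ j < P.levels, ∀ I < P.T, P.instanceFailures (P.roundedLoss l)
      (P.drawn (P.tapeBlocks ω)) i j I ≤ P.maxFailures)
    (hfollow : ∑ t ∈ range P.T, P.followedLoss (P.roundedLoss l) t (P.tapeBlocks ω) ≤
      (∑ t ∈ range P.T, (P.levelLoss (P.roundedLoss l) (P.drawn (P.tapeBlocks ω)) P.levels t : ℝ)) /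
        P.T + 1 + √P.T * (1 + P.wordBits ^ 2)) :
    P.algorithm.regret x l ω ≤ P.totalRegretBound := by
  have hT : (0 : ℝ) < P.T := by exact_mod_cast P.T_pos
  have hlevels := P.sum_levelLoss_levels_le hn (P.roundedLoss_le l)
    (fun t i ht => P.roundedLoss_eq_zero l ht i) (P.drawn (P.tapeBlocks ω)) i fun j hj I => by
      rcases Nat.lt_or_ge I P.T with hI | hI
      · exact hfail j hj I hI
      · simp [P.instanceFailures_eq_zero _ _ _ hI]
  have hexpert : (∑ t ∈ range P.T, (P.roundedLoss l t i : ℝ)) ≤ P.T * ∑ t, (l t i : ℝ) := by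
    rw [← Fin.sum_univ_eq_sum_range (fun t => (P.roundedLoss l t i : ℝ)), mul_sum]
    exact sum_le_sum fun t _ => P.roundedLoss_cast_le l t i
  have hmixed : (∑ t ∈ range P.T,
      (P.levelLoss (P.roundedLoss l) (P.drawn (P.tapeBlocks ω)) P.levels t : ℝ)) / P.T ≤
      ∑ t, (l t i : ℝ) + (P.regretBound P.levels : ℝ) / P.T := by
    calc _ ≤ (P.T * ∑ t, (l t i : ℝ) + P.regretBound P.levels) / P.T :=
          div_le_div_of_nonneg_right (le_trans (by exact_mod_cast hlevels)
            (add_le_add_left hexpert _)) hT.le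
      _ = _ := by rw [add_div, mul_div_cancel_left₀ _ hT.ne']
  rw [ExpertAlgorithm.regret, ← hi, totalRegretBound]
  linarith [P.sum_played_le x l ω]

open scoped Classical in
/-- The random bits for which some instance before day `T` has too many failed trials for
expert `i`, or the loss of the algorithm exceeds its mean by too much. -/
noncomputable def badBlocks (l : ℕ → Fin P.n → ℕ) (i : Fin P.n) : Finset P.Blocks :=
  ((range P.levels ×ˢ range P.T).biUnion fun z =>
    {ψ | P.maxFailures ≤ P.instanceFailures l (P.drawn ψ) i z.1 z.2}) ∪
  ({ψ | (∑ t ∈ range P.T, (P.levelLoss l (P.drawn ψ) P.levels t : ℝ)) / P.T + 1 +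
    √P.T * (1 + P.wordBits ^ 2) < ∑ t ∈ range P.T, P.followedLoss l t ψ} : Finset P.Blocks)

theorem card_badBlocks_le {l : ℕ → Fin P.n → ℕ} (hl : ∀ t i, l t i ≤ P.T) (i : Fin P.n) :
    (#(P.badBlocks l i) : ℝ) ≤
      ((P.T : ℝ) ^ 2 + 1) * Real.exp (-(P.wordBits : ℝ) ^ 2) * Fintype.card P.Blocks := by
  classical
  set W : ℝ := Real.exp (-(P.wordBits : ℝ) ^ 2) * Fintype.card P.Blocks
  set F : ℕ × ℕ → Finset P.Blocks := fun z =>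
    {ψ | P.maxFailures ≤ P.instanceFailures l (P.drawn ψ) i z.1 z.2}
  have hinstance : ∀ z ∈ range P.levels ×ˢ range P.T, (#(F z) : ℝ) ≤ W := fun z hz =>
    (P.card_le_instanceFailures_le l i (mem_range.1 (mem_product.1 hz).1) z.2 _).trans
      (mul_le_mul_of_nonneg_right P.one_sub_pow_maxFailures_le (Nat.cast_nonneg _))
  have hlevels : (P.levels : ℝ) ≤ P.T := by exact_mod_cast Nat.log_le_self _ _
  have hunion : (#((range P.levels ×ˢ range P.T).biUnion F) : ℝ) ≤ (P.T : ℝ) ^ 2 * W := by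
    calc _ ≤ ∑ z ∈ range P.levels ×ˢ range P.T, (#(F z) : ℝ) := by
          exact_mod_cast card_biUnion_le
      _ ≤ P.levels * P.T * W := by simpa using sum_le_card_nsmul _ _ W hinstance
      _ ≤ (P.T : ℝ) ^ 2 * W := by
          rw [sq]
          gcongr
  have hcard : (#(P.badBlocks l i) : ℝ) ≤ (P.T : ℝ) ^ 2 * W + W :=
    (Nat.cast_le.2 (card_union_le _ _)).trans (by
      push_cast
      exact add_le_add hunion (P.card_lt_sum_followedLoss_le hl))
  exact hcard.trans_eq (by ring)

variable {P} in
theorem one_sub_le_prob_regret_le (hn : 1 < P.n) (x l : Fin P.T → Fin P.n → unitInterval) :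
    1 - ((P.T : ℝ) ^ 2 + 1) * Real.exp (-(P.wordBits : ℝ) ^ 2) ≤
      P.algorithm.prob {ω | P.algorithm.regret x l ω ≤ P.totalRegretBound} := by
  obtain ⟨i, hi⟩ := exists_eq_ciInf_of_finite (f := fun i : Fin P.n => ∑ t, (l t i : ℝ))
  refine P.algorithm.one_sub_le_prob P.tapeBlocks (B := P.badBlocks (P.roundedLoss l) i)
    (fun ω hω => ?_) (P.card_badBlocks_le (P.roundedLoss_le l) i)
  simp only [badBlocks, mem_union, mem_biUnion, mem_product, mem_range, mem_filter, mem_univ,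
    true_and, not_or, not_exists, not_and, not_le, not_lt, Prod.forall] at hω
  exact regret_le_totalRegretBound hn hi (fun j hj I hI => (hω.1 j I ⟨hj, hI⟩).le) hω.2

theorem wordBits_le (P : Params) : (P.wordBits : ℝ) ≤ 2 * (1 + Real.log (P.n * P.T)) := by
  have hpos : P.n * P.T ≠ 0 := (Nat.mul_pos P.n_pos P.T_pos).ne'
  have hpow : (2 : ℝ) ^ Nat.log 2 (P.n * P.T) ≤ P.n * P.T := by
    exact_mod_cast Nat.pow_log_le_self 2 hpos
  have hlog := Real.log_le_log (by positivity) hpow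
  rw [Real.log_pow] at hlog
  rw [wordBits]
  push_cast
  nlinarith [Real.log_two_gt_d9, Nat.cast_nonneg (α := ℝ) (Nat.log 2 (P.n * P.T))]

theorem failureProb_le (P : Params) {γ : ℕ} (hT : 1 < P.T) (hγ : γ + 4 ≤ P.wordBits) :
    ((P.T : ℝ) ^ 2 + 1) * Real.exp (-(P.wordBits : ℝ) ^ 2) ≤ 1 / (P.T : ℝ) ^ γ := by
  have hT2 : (2 : ℝ) ≤ P.T := by exact_mod_cast hT
  have hT0 : (0 : ℝ) < P.T := by linarith
  have hexp : (P.T : ℝ) ^ (γ + 4) ≤ Real.exp ((P.wordBits : ℝ) ^ 2) := by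
    rw [← Real.exp_log hT0, ← Real.exp_nat_mul, sq]
    gcongr
    exact log_le_of_lt_two_pow P.T_lt_two_pow_wordBits
  rw [Real.exp_neg, ← div_eq_mul_inv, div_le_div_iff₀ (Real.exp_pos _) (by positivity), one_mul]
  refine le_trans ?_ hexp
  rw [pow_add, mul_comm]
  gcongr
  nlinarith [sq_nonneg ((P.T : ℝ) ^ 2 - 1)]

/-- The parameters with `⌈n ^ δ⌉` pool entries per level, up to logarithmic factors. -/
@[reducible]
noncomputable def ofExponent {δ : ℝ} (hδ : δ ≤ 1) (n T : ℕ+) : Params where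
  n := n
  T := T
  q := ⌈(n : ℝ) ^ δ⌉₊
  n_pos := n.pos
  T_pos := T.pos
  q_pos := Nat.ceil_pos.2 (Real.rpow_pos_of_pos (by exact_mod_cast n.pos) δ)
  q_le := Nat.ceil_le.2 (Real.rpow_le_self_of_one_le (by exact_mod_cast n.pos) hδ)

variable {δ : ℝ} {n T : ℕ+} {c : ℕ}

theorem q_ofExponent_le (hδ0 : 0 ≤ δ) (hδ1 : δ ≤ 1) :
    ((ofExponent hδ1 n T).q : ℝ) ≤ 2 * (n : ℝ) ^ δ := by
  have hpow : (1 : ℝ) ≤ (n : ℝ) ^ δ := Real.one_le_rpow (by exact_mod_cast n.pos) hδ0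
  linarith [Nat.ceil_lt_add_one (zero_le_one.trans hpow)]

theorem spaceAtMost_algorithm (hδ0 : 0 ≤ δ) (hδ1 : δ ≤ 1) (hT : (T : ℕ) ≤ (n : ℕ) ^ c) :
    (ofExponent hδ1 n T).algorithm.SpaceAtMost (8 * (2 + 4 * c + 127 * c * (c + 1)) *
      (n : ℝ) ^ δ * (1 + Real.log ((n : ℝ) * (T : ℝ))) ^ 2) := by
  set P := ofExponent hδ1 n T
  intro x l ω t
  have hq : (P.q : ℝ) ≤ 2 * (n : ℝ) ^ δ := q_ofExponent_le hδ0 hδ1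
  have hwordBits : (P.wordBits : ℝ) ≤ 2 * (1 + Real.log ((n : ℝ) * (T : ℝ))) := P.wordBits_le
  calc ((P.algorithm.words (P.algorithm.state x l ω t)).length : ℝ)
      ≤ (2 + 4 * c + 127 * c * (c + 1)) * (P.q * P.wordBits ^ 2) := by
        exact_mod_cast P.length_memoryWords_le (P.algorithm.state x l ω t).2 (levels_le hT)
    _ ≤ (2 + 4 * c + 127 * c * (c + 1)) *
        (2 * (n : ℝ) ^ δ * (2 * (1 + Real.log ((n : ℝ) * (T : ℝ)))) ^ 2) := by gcongr
    _ = _ := by ring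

/-- There are about `log T / log (n ^ (1 + δ))` levels, and each of them costs a factor `n`. -/
theorem n_pow_levels_le (hδ0 : 0 ≤ δ) (hδ1 : δ ≤ 1) :
    (n : ℝ) ^ (ofExponent hδ1 n T).levels ≤ (T : ℝ) ^ (1 / (1 + δ)) := by
  set P := ofExponent hδ1 n T
  have hn : (0 : ℝ) < (n : ℝ) := by exact_mod_cast n.pos
  have hδ : 0 < 1 + δ := by linarith
  have hepochs : (n : ℝ) ^ (1 + δ) ≤ P.epochs := by
    rw [Real.rpow_add hn, Real.rpow_one, epochs]
    push_cast
    gcongr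
    exact Nat.le_ceil _
  rw [one_div, Real.le_rpow_inv_iff_of_pos (by positivity) (by positivity) hδ]
  calc ((n : ℝ) ^ P.levels) ^ (1 + δ) = ((n : ℝ) ^ (1 + δ)) ^ P.levels := by
        rw [← Real.rpow_natCast, ← Real.rpow_natCast, ← Real.rpow_mul hn.le,
          ← Real.rpow_mul hn.le, mul_comm]
    _ ≤ (P.epochs : ℝ) ^ P.levels := by gcongr
    _ ≤ T := by exact_mod_cast Nat.pow_log_le_self P.epochs P.T_pos.ne'

/-- The rate `n² T ^ (1 / (1 + δ)) (1 + log (n T)) ^ (2 c + 2)` of the regret. -/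
noncomputable def regretRate (δ : ℝ) (n T : ℕ+) (c : ℕ) : ℝ :=
  (n : ℝ) ^ 2 * (T : ℝ) ^ (1 / (1 + δ)) * (1 + Real.log ((n : ℝ) * (T : ℝ))) ^ (2 * c + 2)

theorem one_le_one_add_log (n T : ℕ+) : 1 ≤ 1 + Real.log ((n : ℝ) * (T : ℝ)) :=
  le_add_of_nonneg_right (by exact_mod_cast Real.log_natCast_nonneg (n * T))

theorem one_le_rpow_T (hδ0 : 0 ≤ δ) : (1 : ℝ) ≤ (T : ℝ) ^ (1 / (1 + δ)) :=
  Real.one_le_rpow (by exact_mod_cast T.pos) (by positivity)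

theorem one_le_regretRate (hδ0 : 0 ≤ δ) : 1 ≤ regretRate δ n T c :=
  one_le_mul_of_one_le_of_one_le
    (one_le_mul_of_one_le_of_one_le (one_le_pow₀ (by exact_mod_cast n.pos)) (one_le_rpow_T hδ0))
    (one_le_pow₀ (one_le_one_add_log n T))

theorem regretBound_div_T_le (hδ0 : 0 ≤ δ) (hδ1 : δ ≤ 1) (hT : (T : ℕ) ≤ (n : ℕ) ^ c) :
    ((ofExponent hδ1 n T).regretBound (ofExponent hδ1 n T).levels : ℝ) / T ≤
      40 ^ c * regretRate δ n T c := by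
  set P := ofExponent hδ1 n T
  set y : ℝ := 1 + Real.log ((n : ℝ) * (T : ℝ))
  have hy : 1 ≤ y := one_le_one_add_log n T
  have hwordBits : (P.wordBits : ℝ) ≤ 2 * y := P.wordBits_le
  have hepochs : (P.epochs : ℝ) ≤ (n : ℝ) ^ 2 := by exact_mod_cast P.epochs_le
  have hlevels : (n : ℝ) ^ P.levels ≤ (T : ℝ) ^ (1 / (1 + δ)) := n_pow_levels_le hδ0 hδ1
  have hlog : (10 * (P.wordBits : ℝ) ^ 2) ^ P.levels ≤ 40 ^ c * y ^ (2 * c + 2) := by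
    calc (10 * (P.wordBits : ℝ) ^ 2) ^ P.levels ≤ (10 * (2 * y) ^ 2) ^ P.levels := by gcongr
      _ = (40 * y ^ 2) ^ P.levels := by ring
      _ ≤ (40 * y ^ 2) ^ c := pow_le_pow_right₀ (by nlinarith) (levels_le hT)
      _ = 40 ^ c * y ^ (2 * c) := by rw [mul_pow, ← pow_mul]
      _ ≤ 40 ^ c * y ^ (2 * c + 2) := by
          gcongr
          omega
  calc (P.regretBound P.levels : ℝ) / T
      = P.epochs * (n : ℝ) ^ P.levels * (10 * (P.wordBits : ℝ) ^ 2) ^ P.levels := by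
        have hT0 : (P.T : ℝ) ≠ 0 := by exact_mod_cast P.T_pos.ne'
        rw [regretBound, div_eq_iff hT0]
        push_cast
        rw [mul_pow]
        ring
    _ ≤ (n : ℝ) ^ 2 * (T : ℝ) ^ (1 / (1 + δ)) * (40 ^ c * y ^ (2 * c + 2)) := by gcongr
    _ = 40 ^ c * regretRate δ n T c := by
        rw [regretRate]
        ring

theorem deviation_le (hδ0 : 0 ≤ δ) (hδ1 : δ ≤ 1) :
    2 + √(T : ℝ) * (1 + ((ofExponent hδ1 n T).wordBits : ℝ) ^ 2) ≤ 16 * regretRate δ n T c := by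
  set P := ofExponent hδ1 n T
  set y : ℝ := 1 + Real.log ((n : ℝ) * (T : ℝ))
  have hy : 1 ≤ y := one_le_one_add_log n T
  have hypow : y ^ 2 ≤ y ^ (2 * c + 2) := pow_le_pow_right₀ hy (by omega)
  have hwordBits : (P.wordBits : ℝ) ≤ 2 * y := P.wordBits_le
  have hT : (1 : ℝ) ≤ (T : ℝ) ^ (1 / (1 + δ)) := one_le_rpow_T hδ0
  have hsqrt : √(T : ℝ) ≤ (T : ℝ) ^ (1 / (1 + δ)) := by
    rw [Real.sqrt_eq_rpow]
    exact Real.rpow_le_rpow_of_exponent_le (by exact_mod_cast T.pos)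
      (one_div_le_one_div_of_le (by linarith) (by linarith))
  have hn : (1 : ℝ) ≤ (n : ℝ) ^ 2 := one_le_pow₀ (by exact_mod_cast n.pos)
  calc 2 + √(T : ℝ) * (1 + (P.wordBits : ℝ) ^ 2)
      ≤ 2 * (T : ℝ) ^ (1 / (1 + δ)) + (T : ℝ) ^ (1 / (1 + δ)) * (1 + (2 * y) ^ 2) := by
        gcongr
        linarith
    _ = 1 * (T : ℝ) ^ (1 / (1 + δ)) * (3 + 4 * y ^ 2) := by ring
    _ ≤ (n : ℝ) ^ 2 * (T : ℝ) ^ (1 / (1 + δ)) * (16 * y ^ (2 * c + 2)) := by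
        gcongr
        nlinarith
    _ = 16 * regretRate δ n T c := by
        rw [regretRate]
        ring

theorem totalRegretBound_le (hδ0 : 0 ≤ δ) (hδ1 : δ ≤ 1) (hT : (T : ℕ) ≤ (n : ℕ) ^ c) :
    (ofExponent hδ1 n T).totalRegretBound ≤ (40 ^ c + 16) * regretRate δ n T c := by
  have hlevels := regretBound_div_T_le hδ0 hδ1 hT
  have hdeviation := deviation_le hδ0 hδ1 (n := n) (T := T) (c := c)
  rw [totalRegretBound]
  linarith

theorem one_sub_le_prob_regret_le_regretRate (hδ0 : 0 ≤ δ) (hδ1 : δ ≤ 1)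
    (hT : (T : ℕ) ≤ (n : ℕ) ^ c) (γ : ℕ) (x l : Fin T → Fin n → unitInterval) :
    1 - 1 / (T : ℝ) ^ γ ≤ (ofExponent hδ1 n T).algorithm.prob
      {ω | (ofExponent hδ1 n T).algorithm.regret x l ω ≤
        (40 ^ c + 16 + 2 ^ (γ + 4)) * regretRate δ n T c} := by
  set P := ofExponent hδ1 n T
  have hrate : 1 ≤ regretRate δ n T c := one_le_regretRate hδ0
  have hconst : (2 : ℝ) ^ (γ + 4) ≤ (40 ^ c + 16 + 2 ^ (γ + 4)) * regretRate δ n T c :=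
    (le_mul_of_one_le_right (by positivity) hrate).trans <|
      mul_le_mul_of_nonneg_right (le_add_of_nonneg_left (by positivity)) (zero_le_one.trans hrate)
  have htotal : P.totalRegretBound ≤ (40 ^ c + 16 + 2 ^ (γ + 4)) * regretRate δ n T c :=
    (totalRegretBound_le hδ0 hδ1 hT).trans <|
      mul_le_mul_of_nonneg_right (le_add_of_nonneg_right (by positivity)) (zero_le_one.trans hrate)
  generalize (40 ^ c + 16 + 2 ^ (γ + 4)) * regretRate δ n T c = R at hconst htotal ⊢
  rcases (Nat.one_le_iff_ne_zero.2 T.ne_zero).eq_or_lt with hT1 | hT1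
  · simpa [← hT1] using P.algorithm.prob_nonneg _
  rcases Nat.lt_or_ge P.wordBits (γ + 4) with hwordBits | hwordBits
  · have hTR : (P.T : ℝ) ≤ R := le_trans (by
      exact_mod_cast P.T_lt_two_pow_wordBits.le.trans (Nat.pow_le_pow_right two_pos hwordBits.le))
      hconst
    have hprob : P.algorithm.prob {ω | P.algorithm.regret x l ω ≤ R} = 1 :=
      P.algorithm.prob_eq_one fun ω => (P.algorithm.regret_le x l ω).trans hTR
    exact (sub_le_self _ (by positivity)).trans hprob.ge
  · have hn : 1 < (n : ℕ) := by
      by_contra! hn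
      exact (hT1.trans_le hT).not_ge (pow_le_one' hn c)
    calc 1 - 1 / (T : ℝ) ^ γ ≤ 1 - ((P.T : ℝ) ^ 2 + 1) * Real.exp (-(P.wordBits : ℝ) ^ 2) :=
          sub_le_sub_left (P.failureProb_le hT1 hwordBits) 1
      _ ≤ P.algorithm.prob {ω | P.algorithm.regret x l ω ≤ P.totalRegretBound} :=
          one_sub_le_prob_regret_le (P := P) hn x l
      _ ≤ P.algorithm.prob {ω | P.algorithm.regret x l ω ≤ R} :=
          P.algorithm.prob_mono <| Set.ofPred_subset_ofPred_of_imp fun ω hω => hω.trans htotal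

end Params

theorem theorem1 (δ : ℝ) (hδ : δ ∈ Set.Ioo (0 : ℝ) 1) :
    ∃ A : (n T : ℕ+) → ExpertAlgorithm n T, ∀ c : ℕ,
      (∃ (C : ℝ) (K : ℕ), ∀ n T : ℕ+, (T : ℕ) ≤ (n : ℕ) ^ c →
        (A n T).SpaceAtMost
          (C * (n : ℝ) ^ δ * (1 + Real.log ((n : ℝ) * (T : ℝ))) ^ K)) ∧
      (∀ γ : ℕ, ∃ (C : ℝ) (K : ℕ), ∀ n T : ℕ+, (T : ℕ) ≤ (n : ℕ) ^ c →
        ∀ x l : Fin T → Fin n → unitInterval,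
          1 - 1 / (T : ℝ) ^ γ ≤
            (A n T).prob {ω | (A n T).regret x l ω ≤
              C * (n : ℝ) ^ 2 * (T : ℝ) ^ (1 / (1 + δ)) *
                (1 + Real.log ((n : ℝ) * (T : ℝ))) ^ K}) := by
  refine ⟨fun n T => (Params.ofExponent hδ.2.le n T).algorithm, fun c =>
    ⟨⟨_, 2, fun n T hT => Params.spaceAtMost_algorithm hδ.1.le hδ.2.le hT⟩, fun γ =>
      ⟨40 ^ c + 16 + 2 ^ (γ + 4), 2 * c + 2, fun n T hT x l => ?_⟩⟩⟩
  simpa only [Params.regretRate, mul_assoc] using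
    Params.one_sub_le_prob_regret_le_regretRate hδ.1.le hδ.2.le hT γ x l
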